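/- Let $n\ge 2$, let $A_1,\dots,A_n$ be nontrivial finite groups, let $G_n=A_1*\cdots*A_n$ be their free product and let $\Gamma_n=\mathsf{Out}(G_n)=\mathsf{Aut}(G_n)/\mathsf{Inn}(G_n)$. For $k\neq l$ in $\{1,\dots,n\}$ and $x\in A_l$ let $f_{A_k}^{x}\in\Gamma_n$ be the class of the automorphism of $G_n$ that sends $a$ to $xax^{-1}$ for $a\in A_k$ and is the identity on $A_m$ for every $m\ne k$; put $H_k^l=\{f_{A_k}^{x} : x\in A_l\}$, a subgroup of $\Gamma_n$. Let $i,j\in\{1,\dots,n\}$ be distinct and let $H^{ij}\le\Gamma_n$ be the subgroup generated by all $H_k^i$ and $H_k^j$ with $k\ne i,j$. Then $H^{ij}$ is the internal direct sum of internal free products $$H^{ij}=\bigoplus_{k\neq i,j}\bigl(H_k^i * H_k^j\bigr),$$ and $H^{ij}$ is undistorted in $\Gamma_n$; that is, $\Gamma_n$ and $H^{ij}$ are finitely generated and, for all finite generating sets $S$ of $\Gamma_n$ and $T$ of $H^{ij}$ with word metrics $d_S$ and $d_T$, there are constants $K\ge 1$, $C\ge 0$ such that for all $x,y\in H^{ij}$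 $$\tfrac1K\,d_T(x,y)-C\;\le\; d_S(x,y)\;\le\; K\,d_T(x,y)+C .$$ -/

import Mathlib

open Monoid

namespace FreeProductOut

/-! ### Outer automorphism groups -/

/-- The inner automorphisms form a normal subgroup of the automorphism group. -/
instance innNormal (G : Type*) [Group G] : (MulAut.conj : G →* MulAut G).range.Normal where
  conj_mem := by
    rintro _ ⟨g, rfl⟩ φ
    refine ⟨φ g, ?_⟩
    ext x
    simp [MulAut.conj_apply]

/-- `Out G = Aut G / Inn G`. -/
abbrev Out (G : Type*) [Group G] : Type _ := MulAut G ⧸ (MulAut.conj : G →* MulAut G).range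

/-! ### Partial conjugations of a free product -/

section PartialConj

variable {ι : Type*} [DecidableEq ι] {A : ι → Type*} [∀ i, Group (A i)]

/-- The endomorphism of the free product of the `A k` that sends `a ∈ A i` to `x a x⁻¹` and is the
identity on every other factor; here `x` is an element of the factor `A j`. -/
def partialConjHom (i : ι) {j : ι} (x : A j) : CoprodI A →* CoprodI A :=
  CoprodI.lift fun k =>
    if k = i then (MulAut.conj (CoprodI.of x)).toMonoidHom.comp (CoprodI.of (i := k))
    else CoprodI.of

theorem partialConjHom_of_self {i j : ι} (x : A j) (a : A i) :
    partialConjHom i x (CoprodI.of a) = CoprodI.of x * CoprodI.of a * (CoprodI.of x)⁻¹ := by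
  simp [partialConjHom]

theorem partialConjHom_of_ne {i j k : ι} (h : k ≠ i) (x : A j) (a : A k) :
    partialConjHom i x (CoprodI.of a) = CoprodI.of a := by
  simp [partialConjHom, h]

theorem partialConjHom_comp {i j : ι} (h : j ≠ i) (x y : A j) :
    (partialConjHom i x).comp (partialConjHom i y) = partialConjHom i (y * x) := by
  refine CoprodI.ext_hom _ _ fun k => ?_
  ext a
  by_cases hk : k = i
  · subst hk
    simp [partialConjHom_of_self, partialConjHom_of_ne h, mul_assoc]
  · simp [partialConjHom_of_ne hk]

theorem partialConjHom_comp_self {i : ι} (x y : A i) :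
    (partialConjHom i x).comp (partialConjHom i y) = partialConjHom i (x * y) := by
  refine CoprodI.ext_hom _ _ fun k => ?_
  ext a
  by_cases hk : k = i
  · subst hk
    simp [partialConjHom_of_self, mul_assoc]
  · simp [partialConjHom_of_ne hk]

theorem partialConjHom_one (i j : ι) : partialConjHom i (1 : A j) = MonoidHom.id (CoprodI A) := by
  refine CoprodI.ext_hom _ _ fun k => ?_
  ext a
  by_cases hk : k = i
  · subst hk
    simp [partialConjHom_of_self]
  · simp [partialConjHom_of_ne hk]

theorem partialConjHom_comp_inv (i : ι) {j : ι} (x : A j) :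
    (partialConjHom i x).comp (partialConjHom i x⁻¹) = MonoidHom.id (CoprodI A) := by
  by_cases h : j = i
  · subst h
    rw [partialConjHom_comp_self, mul_inv_cancel, partialConjHom_one]
  · rw [partialConjHom_comp h, inv_mul_cancel, partialConjHom_one]

/-- The automorphism `F_{A_i}^x` of the free product, for `x` in the factor `A j`: conjugation by
`x` on the factor `A i`, identity on every other factor. -/
def partialConj (i : ι) {j : ι} (x : A j) : MulAut (CoprodI A) :=
  MonoidHom.toMulEquiv (partialConjHom i x) (partialConjHom i x⁻¹)
    (by simpa using partialConjHom_comp_inv i x⁻¹) (partialConjHom_comp_inv i x)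

theorem partialConj_apply (i : ι) {j : ι} (x : A j) (g : CoprodI A) :
    partialConj i x g = partialConjHom i x g := rfl

/-- The outer automorphism `f_{A_i}^x` represented by `F_{A_i}^x`. -/
def outerPartialConj (i : ι) {j : ι} (x : A j) : Out (CoprodI A) :=
  QuotientGroup.mk (partialConj i x)

theorem exists_partialConj_mul (i : ι) {j : ι} (x y : A j) :
    ∃ z : A j, partialConj i x * partialConj i y = partialConj i z := by
  by_cases h : j = i
  · subst h
    exact ⟨x * y, MulEquiv.ext fun g => DFunLike.congr_fun (partialConjHom_comp_self x y) g⟩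
  · exact ⟨y * x, MulEquiv.ext fun g => DFunLike.congr_fun (partialConjHom_comp h x y) g⟩

variable (A) in
/-- The subgroup `H_i^j = {f_{A_i}^x | x ∈ A_j}` of the outer automorphism group. -/
def H (i j : ι) : Subgroup (Out (CoprodI A)) where
  carrier := Set.range fun x : A j => outerPartialConj i x
  mul_mem' := by
    rintro _ _ ⟨x, rfl⟩ ⟨y, rfl⟩
    obtain ⟨z, hz⟩ := exists_partialConj_mul i x y
    exact ⟨z, congrArg (QuotientGroup.mk) hz.symm⟩
  one_mem' := ⟨1, congrArg (QuotientGroup.mk)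
    (MulEquiv.ext fun g => DFunLike.congr_fun (partialConjHom_one i j) g)⟩
  inv_mem' := by
    rintro _ ⟨x, rfl⟩
    refine ⟨x⁻¹, eq_inv_of_mul_eq_one_right ?_⟩
    exact congrArg (QuotientGroup.mk) (MulEquiv.ext fun g =>
      DFunLike.congr_fun (partialConjHom_comp_inv i x) g :
        partialConj i x * partialConj i x⁻¹ = 1)

variable (A) in
/-- The subgroup `H^{ij}` generated by all `H_k^i` and `H_k^j` with `k ≠ i, j`. -/
def HH (i j : ι) : Subgroup (Out (CoprodI A)) :=
  ⨆ k : {k : ι // k ≠ i ∧ k ≠ j}, H A k i ⊔ H A k j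

variable (A) in
/-- `H^{ij}` is the internal direct sum, over `k ≠ i, j`, of the internal free products
`H_k^i * H_k^j`: there is an isomorphism from the external direct sum of the external free products
onto `H^{ij}` which on the `k`-th summand is induced by the two inclusions. -/
def HHIsDirectSum (i j : ι) : Prop :=
  ∃ e : (∀ k : {k : ι // k ≠ i ∧ k ≠ j}, Monoid.Coprod (H A k i) (H A k j)) ≃* HH A i j,
    ∀ (k : {k : ι // k ≠ i ∧ k ≠ j}) (w : Monoid.Coprod (H A k i) (H A k j)),
      (e (Pi.mulSingle k w) : Out (CoprodI A)) =
        Monoid.Coprod.lift (H A k i).subtype (H A k j).subtype w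

end PartialConj

/-! ### Undistorted subgroups -/

/-- `f` is a quasi-isometric embedding from the vertex set of the graph `X` to the vertex set of
the graph `Y`, with respect to the path metrics. -/
def IsQIEmbedding {V W : Type*} (X : SimpleGraph V) (Y : SimpleGraph W) (f : V → W) : Prop :=
  ∃ K C : ℝ, 1 ≤ K ∧ 0 ≤ C ∧ ∀ x y : V,
    (X.dist x y : ℝ) / K - C ≤ Y.dist (f x) (f y) ∧
      (Y.dist (f x) (f y) : ℝ) ≤ K * X.dist x y + C

/-- `K` is an undistorted subgroup of `G`: both groups are finitely generated, and the inclusion is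
a quasi-isometric embedding of the Cayley graph of `K` in that of `G`, for all finite generating
sets. (The Cayley graph for `S` joins `g` to `g * s` for `s ∈ S`, so it is connected and its path
metric is the word metric.) -/
def IsUndistorted {G : Type*} [Group G] (K : Subgroup G) : Prop :=
  Group.FG G ∧ Group.FG K ∧
    ∀ (S : Set G) (T : Set K), S.Finite → T.Finite →
      Subgroup.closure S = ⊤ → Subgroup.closure T = ⊤ →
        IsQIEmbedding (SimpleGraph.mulCayley T) (SimpleGraph.mulCayley S) (fun x : K => (x : G))

end FreeProductOut

/-! For a family V, let w_k be the part of V_k in A_i * A_j, and conjugate each A_k with k ≠ i, j by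
w_k⁻¹. Since A_i and A_j stay fixed, composition multiplies the w_k, so this is a homomorphism
(`outerMulti`), and its image is H^{ij}. If such an automorphism is conjugation by g, malnormality
of the factors puts g in A_i ∩ A_j = 1, and then each w_k in A_k ∩ (A_i * A_j) = 1. This gives the
direct sum of free products.

Undistortion amounts to bounding the syllable length of each w_k linearly by word length in Out.
Finite subgroups of a free product are conjugate into factors, so up to a permutation of the factors
every automorphism conjugates each factor; shortening the conjugators writes it as a product of
partial conjugations (`IsConjBy.mem_closure`). Hence Out is finitely generated, and an element of
word length m is a product of O(m) partial conjugations and a factor permutation.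

Fix k and kill all factors except A_i, A_j, A_k. Conjugating all three by y ∈ A_p is inner, so
twisting one of the two factors other than A_p by y is, up to an automorphism of A_p, the same as
twisting the other by y⁻¹. One chosen target per p therefore suffices (`triTwist`), and m partial
conjugations act as `triTwist u` with u of length at most m (`exists_retr_prod_eq`). Ping-pong on
the relative position of three cosets shows that u is determined modulo conjugations and factorwise
automorphisms (`eq_one_of_triTwist`). An element of H^{ij} acts as the twist by w_k, so w_k = u has
length at most m. -/

namespace FreeProductOut

/-! ### Normal forms in a free product -/

section NormalForm

variable {ι : Type*} {A : ι → Type*} [∀ i, Group (A i)]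

/-- The product of a list of letters in the free product. -/
def lprod (l : List (Σ i, A i)) : CoprodI A := (l.map fun s => CoprodI.of s.2).prod

/-- A list of letters is reduced if no letter is trivial and adjacent letters lie in different
factors. -/
def Reduced (l : List (Σ i, A i)) : Prop :=
  (∀ s ∈ l, s.2 ≠ 1) ∧ l.IsChain fun s t => s.1 ≠ t.1

@[simp] theorem lprod_nil : lprod ([] : List (Σ i, A i)) = 1 := rfl

@[simp] theorem lprod_cons (s : Σ i, A i) (l : List (Σ i, A i)) :
    lprod (s :: l) = CoprodI.of s.2 * lprod l := by simp [lprod]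

@[simp] theorem lprod_append (l l' : List (Σ i, A i)) :
    lprod (l ++ l') = lprod l * lprod l' := by simp [lprod]

theorem Reduced.nil : Reduced ([] : List (Σ i, A i)) := by simp [Reduced]

theorem reduced_cons {s : Σ i, A i} {l : List (Σ i, A i)} :
    Reduced (s :: l) ↔ s.2 ≠ 1 ∧ (∀ t ∈ l.head?, s.1 ≠ t.1) ∧ Reduced l := by
  simp only [Reduced, List.mem_cons, forall_eq_or_imp, List.isChain_cons]
  tauto

theorem reduced_append {l l' : List (Σ i, A i)} :
    Reduced (l ++ l') ↔ Reduced l ∧ Reduced l' ∧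
      ∀ s ∈ l.getLast?, ∀ t ∈ l'.head?, s.1 ≠ t.1 := by
  simp only [Reduced, List.mem_append, List.isChain_append]
  constructor
  · rintro ⟨h1, h2, h3, h4⟩
    exact ⟨⟨fun s hs => h1 s (.inl hs), h2⟩, ⟨fun s hs => h1 s (.inr hs), h3⟩, h4⟩
  · rintro ⟨⟨h1, h2⟩, ⟨h1', h3⟩, h4⟩
    exact ⟨fun s hs => hs.elim (h1 s) (h1' s), h2, h3, h4⟩

variable [DecidableEq ι]

open scoped Classical in
/-- The normal form of an element of the free product. -/
noncomputable def nf (g : CoprodI A) : List (Σ i, A i) := (CoprodI.Word.equiv g).toList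

theorem reduced_nf (g : CoprodI A) : Reduced (nf g) :=
  ⟨fun s hs => (CoprodI.Word.ne_one _ s hs), CoprodI.Word.chain_ne _⟩

@[simp] theorem lprod_nf (g : CoprodI A) : lprod (nf g) = g := by
  classical
  exact CoprodI.Word.equiv.symm_apply_apply g

theorem nf_lprod {l : List (Σ i, A i)} (h : Reduced l) : nf (lprod l) = l := by
  classical
  let w : CoprodI.Word A := ⟨l, h.1, h.2⟩
  have : CoprodI.Word.equiv (lprod l) = w := CoprodI.Word.equiv.apply_symm_apply w
  exact congrArg CoprodI.Word.toList this

theorem nf_eq {l : List (Σ i, A i)} {g : CoprodI A} (h : Reduced l) (hg : g = lprod l) :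
    nf g = l := hg ▸ nf_lprod h

@[simp] theorem nf_one : nf (1 : CoprodI A) = [] := nf_lprod Reduced.nil

theorem nf_eq_nil {g : CoprodI A} : nf g = [] ↔ g = 1 :=
  ⟨fun h => by rw [← lprod_nf g, h, lprod_nil], fun h => by rw [h, nf_one]⟩

theorem nf_of {i : ι} {a : A i} (h : a ≠ 1) : nf (CoprodI.of a) = [⟨i, a⟩] :=
  nf_eq (by simp [Reduced, h]) (by simp)

/-- The normal form of `g` starts with a letter of the factor `i`. -/
def StartsIn (i : ι) (g : CoprodI A) : Prop := ∃ s ∈ (nf g).head?, s.1 = i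

/-- The normal form of `g` ends with a letter of the factor `i`. -/
def EndsIn (i : ι) (g : CoprodI A) : Prop := ∃ s ∈ (nf g).getLast?, s.1 = i

theorem StartsIn.exists {i : ι} {g : CoprodI A} (h : StartsIn i g) :
    ∃ (a : A i) (t : List (Σ i, A i)), nf g = ⟨i, a⟩ :: t := by
  obtain ⟨⟨j, a⟩, hs, rfl⟩ := h
  exact ⟨a, _, List.eq_cons_of_mem_head? hs⟩

theorem EndsIn.exists {i : ι} {g : CoprodI A} (h : EndsIn i g) :
    ∃ (a : A i) (t : List (Σ i, A i)), nf g = t ++ [⟨i, a⟩] := by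
  obtain ⟨⟨j, a⟩, hs, rfl⟩ := h
  exact ⟨a, _, (List.dropLast_append_getLast? _ hs).symm⟩

theorem startsIn_of_nf {i : ι} {g : CoprodI A} {a : A i} {t : List (Σ i, A i)}
    (h : nf g = ⟨i, a⟩ :: t) : StartsIn i g := ⟨⟨i, a⟩, by simp [h], rfl⟩

theorem not_startsIn_one (i : ι) : ¬ StartsIn i (1 : CoprodI A) := by simp [StartsIn]

theorem StartsIn.eq {i j : ι} {g : CoprodI A} (h : StartsIn i g) (h' : StartsIn j g) : i = j := by
  obtain ⟨s, hs, rfl⟩ := h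
  obtain ⟨t, ht, rfl⟩ := h'
  rw [Option.mem_unique hs ht]

theorem nf_mul {g h : CoprodI A} (H : ∀ i, EndsIn i g → ¬ StartsIn i h) :
    nf (g * h) = nf g ++ nf h := by
  refine nf_eq (reduced_append.2 ⟨reduced_nf g, reduced_nf h, fun s hs t ht e => ?_⟩) (by simp)
  exact H s.1 ⟨s, hs, rfl⟩ ⟨t, ht, e.symm⟩

theorem nf_of_mul {i : ι} {a : A i} (ha : a ≠ 1) {g : CoprodI A} (hg : ¬ StartsIn i g) :
    nf (CoprodI.of a * g) = ⟨i, a⟩ :: nf g := by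
  rw [nf_mul, nf_of ha]; · rfl
  rintro j ⟨s, hs, rfl⟩
  rw [nf_of ha] at hs
  obtain rfl : (⟨i, a⟩ : Σ i, A i) = s := by simpa using hs
  exact hg

theorem StartsIn.of_mul {i : ι} {a : A i} (ha : a ≠ 1) {g : CoprodI A} (hg : ¬ StartsIn i g) :
    StartsIn i (CoprodI.of a * g) := startsIn_of_nf (nf_of_mul ha hg)

theorem not_startsIn_tail {s : Σ i, A i} {t : List (Σ i, A i)} (h : Reduced (s :: t)) :
    ¬ StartsIn s.1 (lprod t) := by
  rintro ⟨u, hu, e⟩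
  rw [nf_lprod (reduced_cons.1 h).2.2] at hu
  exact (reduced_cons.1 h).2.1 u hu e.symm

theorem exists_eq_of_mul (i : ι) (g : CoprodI A) :
    ∃ (a : A i) (y : CoprodI A), g = CoprodI.of a * y ∧ ¬ StartsIn i y := by
  by_cases h : StartsIn i g
  · obtain ⟨a, t, e⟩ := h.exists
    have hr := reduced_nf g
    rw [e] at hr
    exact ⟨a, lprod t, by rw [← lprod_nf g, e]; simp, not_startsIn_tail hr⟩
  · exact ⟨1, g, by simp, h⟩

theorem of_mul_inj {i : ι} {a b : A i} {x y : CoprodI A} (hx : ¬ StartsIn i x)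
    (hy : ¬ StartsIn i y) (h : CoprodI.of a * x = CoprodI.of b * y) : a = b := by
  by_contra hab
  refine hy ?_
  have : y = CoprodI.of (b⁻¹ * a) * x := by
    rw [map_mul, mul_assoc, h, map_inv, inv_mul_cancel_left]
  rw [this]
  exact StartsIn.of_mul (fun e => hab (inv_mul_eq_one.1 e).symm) hx

/-- The component in `A i` at the beginning of `g`. -/
noncomputable def hd (i : ι) (g : CoprodI A) : A i := (exists_eq_of_mul i g).choose

theorem exists_eq_hd_mul (i : ι) (g : CoprodI A) :
    ∃ y, g = CoprodI.of (hd i g) * y ∧ ¬ StartsIn i y := (exists_eq_of_mul i g).choose_spec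

theorem hd_of_mul_of_not_startsIn {i : ι} (a : A i) {y : CoprodI A} (hy : ¬ StartsIn i y) :
    hd i (CoprodI.of a * y) = a := by
  obtain ⟨z, hz, hz'⟩ := exists_eq_hd_mul i (CoprodI.of a * y)
  exact (of_mul_inj hy hz' hz).symm

@[simp] theorem hd_of_mul {i : ι} (a : A i) (g : CoprodI A) :
    hd i (CoprodI.of a * g) = a * hd i g := by
  obtain ⟨y, hy, hy'⟩ := exists_eq_hd_mul i g
  conv_lhs => rw [hy, ← mul_assoc, ← map_mul]
  exact hd_of_mul_of_not_startsIn _ hy'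

theorem hd_of_not_startsIn {i : ι} {y : CoprodI A} (hy : ¬ StartsIn i y) : hd i y = 1 := by
  simpa using hd_of_mul_of_not_startsIn 1 hy

theorem hd_congr {i : ι} {g h : CoprodI A} (e : (nf g).head? = (nf h).head?) :
    hd i g = hd i h := by
  by_cases hg : StartsIn i g
  · obtain ⟨a, t, et⟩ := hg.exists
    have hh : StartsIn i h := by rwa [StartsIn, ← e]
    obtain ⟨b, u, eu⟩ := hh.exists
    have hab : a = b := by simpa [et, eu] using e
    have key : ∀ {g : CoprodI A} {a : A i} {t}, nf g = ⟨i, a⟩ :: t → hd i g = a := by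
      intro g a t et
      have hr := reduced_nf g
      rw [et] at hr
      rw [← lprod_nf g, et, lprod_cons]
      exact hd_of_mul_of_not_startsIn a (not_startsIn_tail hr)
    rw [key et, key eu, hab]
  · have hh : ¬ StartsIn i h := by rwa [StartsIn, ← e]
    rw [hd_of_not_startsIn hg, hd_of_not_startsIn hh]

theorem nf_inv (g : CoprodI A) :
    nf g⁻¹ = ((nf g).map fun s => (⟨s.1, s.2⁻¹⟩ : Σ i, A i)).reverse := by
  refine nf_eq ⟨?_, ?_⟩ ?_
  · simp only [List.mem_reverse, List.mem_map]
    rintro _ ⟨s, hs, rfl⟩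
    exact inv_ne_one.2 ((reduced_nf g).1 s hs)
  · rw [List.isChain_reverse, List.isChain_map]
    exact (reduced_nf g).2.imp fun _ _ h => h.symm
  · conv_lhs => rw [← lprod_nf g]
    generalize nf g = l
    induction l with
    | nil => simp
    | cons s l ih => simp [ih]

theorem startsIn_inv {i : ι} {g : CoprodI A} : StartsIn i g⁻¹ ↔ EndsIn i g := by
  simp only [StartsIn, EndsIn, nf_inv, List.head?_reverse, List.getLast?_map, Option.mem_def,
    Option.map_eq_some_iff]
  constructor
  · rintro ⟨_, ⟨s, hs, rfl⟩, rfl⟩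
    exact ⟨s, hs, rfl⟩
  · rintro ⟨s, hs, rfl⟩
    exact ⟨_, ⟨s, hs, rfl⟩, rfl⟩

theorem endsIn_inv {i : ι} {g : CoprodI A} : EndsIn i g⁻¹ ↔ StartsIn i g := by
  rw [← startsIn_inv, inv_inv]

/-- The syllable length. -/
noncomputable def len (g : CoprodI A) : ℕ := (nf g).length

@[simp] theorem len_one : len (1 : CoprodI A) = 0 := by simp [len]

theorem len_eq_zero {g : CoprodI A} : len g = 0 ↔ g = 1 := by
  rw [len, List.length_eq_zero_iff, nf_eq_nil]

theorem len_of_mul_le {i : ι} (a : A i) (g : CoprodI A) : len (CoprodI.of a * g) ≤ len g + 1 := by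
  have key : ∀ (b : A i) {y : CoprodI A}, ¬ StartsIn i y → len y ≤ len (CoprodI.of b * y) ∧
      len (CoprodI.of b * y) ≤ len y + 1 := by
    intro b y hy
    by_cases hb : b = 1
    · simp [hb]
    · simp [len, nf_of_mul hb hy]
  obtain ⟨b, y, rfl, hy⟩ := exists_eq_of_mul i g
  rw [← mul_assoc, ← map_mul]
  have h1 := key (a * b) hy
  have h2 := key b hy
  omega

theorem len_lprod_le (l : List (Σ i, A i)) : len (lprod l) ≤ l.length := by
  induction l with
  | nil => simp
  | cons s l ih =>
    rw [lprod_cons, List.length_cons]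
    exact (len_of_mul_le _ _).trans (by omega)

theorem len_mul_le (g h : CoprodI A) : len (g * h) ≤ len g + len h := by
  have := len_lprod_le (nf g ++ nf h)
  simpa [len] using this

theorem len_of_le {i : ι} (a : A i) : len (CoprodI.of a) ≤ 1 := by
  simpa using len_of_mul_le a 1

theorem len_mul {g h : CoprodI A} (H : ∀ i, EndsIn i g → ¬ StartsIn i h) :
    len (g * h) = len g + len h := by simp [len, nf_mul H]

theorem exists_startsIn {g : CoprodI A} (h : g ≠ 1) : ∃ i, StartsIn i g := by
  rcases e : nf g with _ | ⟨⟨i, a⟩, t⟩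
  · exact absurd (nf_eq_nil.1 e) h
  · exact ⟨i, startsIn_of_nf e⟩

theorem exists_endsIn {g : CoprodI A} (h : g ≠ 1) : ∃ i, EndsIn i g := by
  obtain ⟨i, hi⟩ := exists_startsIn (inv_ne_one.2 h)
  exact ⟨i, startsIn_inv.1 hi⟩

theorem exists_eq_mul_of (i : ι) (g : CoprodI A) :
    ∃ (a : A i) (y : CoprodI A), g = y * CoprodI.of a ∧ ¬ EndsIn i y := by
  obtain ⟨a, y, h, hy⟩ := exists_eq_of_mul i g⁻¹
  refine ⟨a⁻¹, y⁻¹, ?_, by rwa [endsIn_inv]⟩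
  rw [← inv_inv g, h]
  simp

/-- Factors are malnormal. -/
theorem malnormal {i j : ι} {a : A i} (ha : a ≠ 1) {b : A j} {g : CoprodI A}
    (h : g * CoprodI.of a * g⁻¹ = CoprodI.of b) : i = j ∧ ∃ c : A i, g = CoprodI.of c := by
  -- Absorb the final A i-letter of g into a. Then y d y⁻¹ is reduced of length 2|y| + 1, and it can
  -- only have length at most one if y = 1.
  obtain ⟨c, y, rfl, hy⟩ := exists_eq_mul_of i g
  have hd : c * a * c⁻¹ ≠ 1 := by simpa using ha
  have h' : y * CoprodI.of (c * a * c⁻¹) * y⁻¹ = CoprodI.of b := by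
    rw [← h]; simp [mul_assoc]
  generalize c * a * c⁻¹ = d at *
  have hy1 : y = 1 := by
    by_contra hne
    have e1 : nf (CoprodI.of d * y⁻¹) = ⟨i, d⟩ :: nf y⁻¹ :=
      nf_of_mul hd (by rwa [startsIn_inv])
    have e2 : nf (y * (CoprodI.of d * y⁻¹)) = nf y ++ ⟨i, d⟩ :: nf y⁻¹ := by
      rw [nf_mul, e1]
      rintro j hj ⟨s, hs, rfl⟩
      rw [e1] at hs
      obtain rfl : (⟨i, d⟩ : Σ i, A i) = s := by simpa using hs
      exact hy hj
    rw [← mul_assoc, h'] at e2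
    have h3 := len_of_le b
    have h4 : len y ≠ 0 := fun e => hne (len_eq_zero.1 e)
    simp only [len, e2, List.length_append, List.length_cons] at h3 h4
    omega
  subst hy1
  refine ⟨?_, c, by simp⟩
  have hb : b ≠ 1 := by
    rintro rfl
    have : (CoprodI.of d : CoprodI A) = 1 := by simpa using h'
    exact hd (CoprodI.of_injective i (by simpa using this))
  have e : [(⟨i, d⟩ : Σ i, A i)] = [⟨j, b⟩] := by
    rw [← nf_of hd, ← nf_of hb, ← h']; simp
  exact congrArg Sigma.fst (List.cons.inj e).1

theorem mem_range_of_len_le_one [Nonempty ι] {g : CoprodI A} (h : len g ≤ 1) :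
    ∃ (i : ι) (a : A i), g = CoprodI.of a := by
  rcases e : nf g with _ | ⟨⟨i, a⟩, t⟩
  · exact ⟨Classical.arbitrary ι, 1, by simpa using nf_eq_nil.1 e⟩
  · refine ⟨i, a, ?_⟩
    simp only [len, e, List.length_cons] at h
    obtain rfl : t = [] := List.length_eq_zero_iff.1 (by omega)
    rw [← lprod_nf g, e]; simp

end NormalForm

/-! ### Finite subgroups of free products -/

section FiniteSubgroups

variable {ι : Type*} [DecidableEq ι] {A : ι → Type*} [∀ i, Group (A i)]

/-- The merging case: the touching letters combine without cancelling, so exactly one syllable is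
lost. -/
theorem nf_mul_of_endsIn {g h : CoprodI A} {i : ι} {a b : A i} {t u : List (Σ i, A i)}
    (hg : nf g = t ++ [⟨i, a⟩]) (hh : nf h = ⟨i, b⟩ :: u) (hab : a * b ≠ 1) :
    nf (g * h) = t ++ ⟨i, a * b⟩ :: u := by
  have h1 := reduced_nf g
  have h2 := reduced_nf h
  rw [hg, reduced_append] at h1
  rw [hh, reduced_cons] at h2
  refine nf_eq (reduced_append.2 ⟨h1.1, reduced_cons.2 ⟨hab, h2.2⟩, ?_⟩) ?_
  · intro s hs r hr
    obtain rfl : (⟨i, a * b⟩ : Σ i, A i) = r := by simpa using hr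
    exact h1.2.2 s hs ⟨i, a⟩ rfl
  · conv_lhs => rw [← lprod_nf g, ← lprod_nf h, hg, hh]
    simp [mul_assoc]

/-- A nontrivial finite subgroup that contains an element of length at least two has a conjugate
all of whose nontrivial elements are shorter. -/
theorem exists_conj_len_lt {K : Type*} [Group K] [Finite K] (ρ : K →* CoprodI A)
    (hρ : ∃ x, 2 ≤ len (ρ x)) :
    ∃ g : CoprodI A, ∀ x, ρ x ≠ 1 → len (g * ρ x * g⁻¹) < len (ρ x) := by
  obtain ⟨x, hx⟩ := Finite.exists_max fun x => len (ρ x)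
  have hL : 2 ≤ len (ρ x) := by
    obtain ⟨y, hy⟩ := hρ
    exact hy.trans (hx y)
  obtain ⟨p, hp⟩ := exists_endsIn (g := ρ x) (by rintro h; rw [h, len_one] at hL; omega)
  -- Otherwise x * y has no merging and is longer than the longest element x.
  have start : ∀ y, ρ y ≠ 1 → StartsIn p (ρ y) := by
    intro y hy
    by_contra hs
    have h1 : len (ρ (x * y)) = len (ρ x) + len (ρ y) := by
      rw [map_mul, len_mul]
      intro i hi hi'
      obtain rfl : i = p := by
        rw [← startsIn_inv] at hi hp
        exact hi.eq hp
      exact hs hi'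
    have h2 := hx (x * y)
    have h3 : len (ρ y) ≠ 0 := fun e => hy (len_eq_zero.1 e)
    omega
  obtain ⟨c, t, ht⟩ := hp.exists
  -- If the last letter c of x only merged with the first letter of y, then x * y would have length
  -- |x| + |y| - 1 > |x|. So the two letters cancel.
  have big : ∀ y, 2 ≤ len (ρ y) → ∃ u, nf (ρ y) = ⟨p, c⁻¹⟩ :: u := by
    intro y hy
    obtain ⟨b, u, hu⟩ := (start y (by rintro h; rw [h, len_one] at hy; omega)).exists
    by_cases hcb : c * b = 1
    · exact ⟨u, by rw [hu, eq_inv_of_mul_eq_one_right hcb]⟩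
    · have e := nf_mul_of_endsIn ht hu hcb
      rw [← map_mul] at e
      have h2 := hx (x * y)
      simp only [len, e, ht, hu, List.length_append, List.length_cons, List.length_nil] at h2 hy
      omega
  -- A single letter b would lie in A p. If b = c, then y * x is a nontrivial tail of x not starting
  -- in A p, against `start`. Otherwise y * x begins with b c⁻¹, and `big` forces b = 1.
  have all : ∀ y, ρ y ≠ 1 → 2 ≤ len (ρ y) := by
    intro y hy
    by_contra hlt
    obtain ⟨b, u, hu⟩ := (start y hy).exists
    obtain rfl : u = [] := by
      simp only [len, hu, List.length_cons] at hlt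
      exact List.length_eq_zero_iff.1 (by omega)
    obtain ⟨v, hv⟩ := big x hL
    have hb : b ≠ 1 := by
      have := (reduced_nf (ρ y)).1 ⟨p, b⟩ (by simp [hu])
      exact this
    by_cases hbc : b * c⁻¹ = 1
    · have hr := reduced_nf (ρ x)
      rw [hv] at hr
      have e : ρ (y * x) = lprod v := by
        rw [map_mul, ← lprod_nf (ρ x), ← lprod_nf (ρ y), hu, hv]
        simp [mul_inv_eq_one.1 hbc]
      refine not_startsIn_tail hr ?_
      rw [← e]
      refine start _ fun h1 => ?_
      have h0 : v = [] := by
        rw [← nf_lprod (reduced_cons.1 hr).2.2, ← e, h1, nf_one]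
      simp [len, hv, h0] at hL
    · have e := nf_mul_of_endsIn (t := []) hu hv hbc
      rw [← map_mul] at e
      obtain ⟨w, hw⟩ := big (y * x) (by
        simp only [len, hv, e, List.length_cons, List.nil_append] at hL ⊢
        exact hL)
      rw [e] at hw
      have : b * c⁻¹ = c⁻¹ := by simpa using (List.cons.inj hw).1
      exact hb (by simpa using this)
  -- Applying `big` to y and y⁻¹, every nontrivial element has the form c⁻¹ ⋯ c, and conjugation by
  -- c strips both ends.
  refine ⟨CoprodI.of c, fun y hy => ?_⟩
  obtain ⟨u, hu⟩ := big y (all y hy)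
  have hyi : ρ y⁻¹ ≠ 1 := by simpa using hy
  obtain ⟨v, hv⟩ := big y⁻¹ (all _ hyi)
  have e : nf (ρ y) = (v.map fun s => (⟨s.1, s.2⁻¹⟩ : Σ i, A i)).reverse ++ [⟨p, c⟩] := by
    rw [← inv_inv (ρ y), nf_inv, ← map_inv, hv]
    simp
  generalize (v.map fun s => (⟨s.1, s.2⁻¹⟩ : Σ i, A i)).reverse = w at e
  have h2 := all y hy
  have hyl : len (ρ y) = w.length + 1 := by simp [len, e]
  rcases w with _ | ⟨s, w⟩
  · simp at hyl; omega
  · obtain ⟨rfl, -⟩ : s = ⟨p, c⁻¹⟩ ∧ w ++ [⟨p, c⟩] = u := by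
      rw [hu] at e
      exact ⟨(List.cons.inj e).1.symm, (List.cons.inj e).2.symm⟩
    have : CoprodI.of c * ρ y * (CoprodI.of c)⁻¹ = lprod w := by
      rw [← lprod_nf (ρ y), e]
      simp
    rw [this, hyl]
    refine (len_lprod_le w).trans_lt ?_
    simp

/-- A finite subgroup of a free product is conjugate into a factor. -/
theorem exists_conj_mem_factor [Nonempty ι] {K : Type*} [Group K] [Finite K]
    (ρ : K →* CoprodI A) :
    ∃ (g : CoprodI A) (i : ι), ∀ x, ∃ a : A i, ρ x = g * CoprodI.of a * g⁻¹ := by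
  have := Fintype.ofFinite K
  -- Induction on the total length of all images: conjugating by the element from
  -- `exists_conj_len_lt` lowers it.
  induction h : ∑ x, len (ρ x) using Nat.strong_induction_on generalizing ρ with
  | _ N ih =>
  by_cases hρ : ∃ x, 2 ≤ len (ρ x)
  · obtain ⟨g, hg⟩ := exists_conj_len_lt ρ hρ
    let ρ' : K →* CoprodI A := (MulAut.conj g).toMonoidHom.comp ρ
    have hρ' : ∀ x, ρ' x = g * ρ x * g⁻¹ := fun x => rfl
    have hlt : ∑ x, len (ρ' x) < N := by
      rw [← h]
      refine Finset.sum_lt_sum (fun x _ => ?_) ?_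
      · by_cases hx : ρ x = 1
        · simp [hρ', hx]
        · exact (hg x hx).le
      · obtain ⟨x, hx⟩ := hρ
        exact ⟨x, Finset.mem_univ _, hg x (by rintro h; rw [h, len_one] at hx; omega)⟩
    obtain ⟨g', i, hi⟩ := ih _ hlt ρ' rfl
    refine ⟨g⁻¹ * g', i, fun x => ?_⟩
    obtain ⟨a, ha⟩ := hi x
    refine ⟨a, ?_⟩
    rw [hρ'] at ha
    have : ρ x = g⁻¹ * (g * ρ x * g⁻¹) * g := by group
    rw [this, ha]
    group
  · push Not at hρ
    by_cases h1 : ∀ x, ρ x = 1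
    · exact ⟨1, Classical.arbitrary ι, fun x => ⟨1, by simp [h1]⟩⟩
    · push Not at h1
      obtain ⟨x, hx⟩ := h1
      obtain ⟨i, a, ha⟩ := mem_range_of_len_le_one (g := ρ x) (by have := hρ x; omega)
      have ha1 : a ≠ 1 := by
        rintro rfl
        exact hx (by simpa using ha)
      refine ⟨1, i, fun y => ?_⟩
      obtain ⟨j, b, hb⟩ := mem_range_of_len_le_one (g := ρ y) (by have := hρ y; omega)
      by_cases hb1 : b = 1
      · exact ⟨1, by simp [hb, hb1]⟩
      by_cases hij : i = j
      · subst hij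
        exact ⟨b, by simp [hb]⟩
      -- All images have length at most one, but nontrivial letters from different factors would
      -- have a product of length two.
      · exfalso
        have h2 := hρ (x * y)
        rw [map_mul, len_mul, ha, hb, len, len, nf_of ha1, nf_of hb1] at h2
        · simp at h2
        · rw [ha, hb]
          rintro k ⟨s, hs, rfl⟩ ⟨t, ht, e⟩
          rw [nf_of ha1] at hs
          rw [nf_of hb1] at ht
          obtain rfl : (⟨i, a⟩ : Σ i, A i) = s := by simpa using hs
          obtain rfl : (⟨j, b⟩ : Σ i, A i) = t := by simpa using ht
          exact hij e.symm

end FiniteSubgroups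

/-! ### Generators of the automorphism group -/

section Generators

variable {ι : Type*} [DecidableEq ι] {A : ι → Type*} [∀ i, Group (A i)]

theorem partialConj_of_self {i j : ι} (x : A j) (a : A i) :
    partialConj i x (CoprodI.of a) = CoprodI.of x * CoprodI.of a * (CoprodI.of x)⁻¹ :=
  partialConjHom_of_self x a

theorem partialConj_of_ne {i j k : ι} (h : k ≠ i) (x : A j) (a : A k) :
    partialConj i x (CoprodI.of a) = CoprodI.of a :=
  partialConjHom_of_ne h x a

omit [DecidableEq ι] in
theorem mulAut_ext {φ ψ : MulAut (CoprodI A)}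
    (h : ∀ (k : ι) (a : A k), φ (CoprodI.of a) = ψ (CoprodI.of a)) : φ = ψ := by
  have : φ.toMonoidHom = ψ.toMonoidHom :=
    CoprodI.ext_hom _ _ fun k => MonoidHom.ext fun a => h k a
  exact MulEquiv.ext fun x => DFunLike.congr_fun this x

variable (A) in
/-- The set of all partial conjugations. -/
def partialConjSet : Set (MulAut (CoprodI A)) :=
  Set.range fun p : ι × (Σ j, A j) => partialConj p.1 p.2.2

theorem partialConj_mem (i : ι) {j : ι} (x : A j) : partialConj i x ∈ partialConjSet A :=
  ⟨(i, ⟨j, x⟩), rfl⟩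

/-- `φ` conjugates the factor `A k` by `g k`. -/
def IsConjBy (φ : MulAut (CoprodI A)) (g : ι → CoprodI A) : Prop :=
  ∀ (k : ι) (a : A k), φ (CoprodI.of a) = g k * CoprodI.of a * (g k)⁻¹

/-- Only the conjugator of A l changes, and it is multiplied by φ(a). This one move drives both the
shortening of conjugators and the ping-pong below. -/
theorem IsConjBy.mul_partialConj {φ : MulAut (CoprodI A)} {g : ι → CoprodI A}
    (h : IsConjBy φ g) {k : ι} (a : A k) (l : ι) :
    IsConjBy (φ * partialConj l a)
      (Function.update g l (g k * CoprodI.of a * (g k)⁻¹ * g l)) := by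
  intro m b
  by_cases hm : m = l
  · subst hm
    simp [partialConj_of_self, h k a, h m b, mul_assoc]
  · simp [partialConj_of_ne hm, h m b, hm]

/-- If no conjugator can be shortened by a partial conjugation then the automorphism is trivial. -/
theorem IsConjBy.eq_one {φ : MulAut (CoprodI A)} {g : ι → CoprodI A} (h : IsConjBy φ g)
    (h1 : ∀ k, ¬ EndsIn k (g k))
    (h2 : ∀ k l, k ≠ l → ∀ (a : A k) t, nf (g l) ≠ nf (g k) ++ ⟨k, a⟩ :: t) : φ = 1 := by
  -- As g k does not end in A k, nothing cancels in g k · ((g k)⁻¹ y), so y has g k followed by a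
  -- letter of A k as a prefix.
  have pre : ∀ {k y}, StartsIn k ((g k)⁻¹ * y) →
      ∃ (a : A k) (t : List (Σ i, A i)), nf y = nf (g k) ++ ⟨k, a⟩ :: t := by
    intro k y hy
    obtain ⟨a, t, e⟩ := hy.exists
    refine ⟨a, t, ?_⟩
    rw [← e, ← nf_mul, mul_inv_cancel_left]
    intro i hi hi'
    obtain rfl := hy.eq hi'
    exact h1 _ hi
  -- The ping-pong sets are disjoint: of two such prefixes of y, either their last letters coincide,
  -- giving k = l, or one conjugator extends the other as `h2` forbids.
  have disj : ∀ {k l y}, StartsIn k ((g k)⁻¹ * y) → StartsIn l ((g l)⁻¹ * y) → k = l := by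
    intro k l y hk hl
    obtain ⟨a, t, e⟩ := pre hk
    obtain ⟨b, u, e'⟩ := pre hl
    by_contra hkl
    rw [e, List.append_eq_append_iff] at e'
    rcases e' with ⟨w, hw, hw'⟩ | ⟨w, hw, hw'⟩
    · rcases w with _ | ⟨s, w⟩
      · exact hkl (congrArg Sigma.fst (List.cons.inj (show _ :: _ = _ :: _ from hw')).1)
      · obtain rfl : (⟨k, a⟩ : Σ i, A i) = s := (List.cons.inj hw').1
        exact h2 k l hkl a w hw
    · rcases w with _ | ⟨s, w⟩
      · exact hkl (congrArg Sigma.fst (List.cons.inj (show _ :: _ = _ :: _ from hw')).1.symm)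
      · obtain rfl : (⟨l, b⟩ : Σ i, A i) = s := (List.cons.inj hw').1
        exact h2 l k (Ne.symm hkl) b w hw
  -- Ping-pong: φ sends a reduced word with first letter in A k into the set of words beginning with
  -- g k and a letter of A k.
  have start : ∀ v : List (Σ i, A i), Reduced v → ∀ s ∈ v.head?,
      StartsIn s.1 ((g s.1)⁻¹ * φ (lprod v)) := by
    intro v
    induction v with
    | nil => simp
    | cons s t ih =>
      intro hv r hr
      obtain rfl : s = r := by simpa using hr
      obtain ⟨hs1, hs2, ht⟩ := reduced_cons.1 hv
      rw [lprod_cons, map_mul, h, mul_assoc, mul_assoc, inv_mul_cancel_left]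
      refine StartsIn.of_mul hs1 fun hc => ?_
      rcases t with _ | ⟨r, t⟩
      · rw [lprod_nil, map_one, mul_one, startsIn_inv] at hc
        exact h1 _ hc
      · exact hs2 r rfl (disj hc (ih ht r rfl))
  refine mulAut_ext fun k a => ?_
  by_cases ha : a = 1
  · simp [ha]
  -- Surjectivity enters here: the single letter a is φ of some reduced word, so it has a conjugator
  -- as a proper prefix. That conjugator is trivial, and its index is k.
  have hg : g k = 1 := by
    have hne : nf (φ⁻¹ (CoprodI.of a)) ≠ [] := by
      rw [Ne, nf_eq_nil]
      intro e
      rw [EmbeddingLike.map_eq_one_iff] at e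
      exact ha (CoprodI.of_injective k (by simpa using e))
    obtain ⟨s, t, e⟩ := List.exists_cons_of_ne_nil hne
    have hr := reduced_nf (φ⁻¹ (CoprodI.of a))
    have := start _ hr s (by rw [e]; rfl)
    rw [lprod_nf, ← MulAut.mul_apply, mul_inv_cancel, MulAut.one_apply] at this
    obtain ⟨b, u, e'⟩ := pre this
    rw [nf_of ha, eq_comm, List.append_eq_singleton_iff] at e'
    rcases e' with ⟨e1, e2⟩ | ⟨-, e2⟩
    · have : s.1 = k := congrArg Sigma.fst (List.cons.inj e2).1
      rw [← this]
      exact nf_eq_nil.1 e1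
    · simp at e2
  simp [h k a, hg]

/-- An automorphism that conjugates every factor is a product of partial conjugations. -/
theorem IsConjBy.mem_closure [Finite ι] {φ : MulAut (CoprodI A)} {g : ι → CoprodI A}
    (h : IsConjBy φ g) : φ ∈ Subgroup.closure (partialConjSet A) := by
  have := Fintype.ofFinite ι
  induction hN : ∑ k, len (g k) using Nat.strong_induction_on generalizing φ g with
  | _ N ih =>
  -- Any partial conjugation that shortens one conjugator lowers the total length, so induction
  -- applies.
  have step : ∀ (k l : ι) (a : A k), len (g k * CoprodI.of a * (g k)⁻¹ * g l) < len (g l) →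
      φ ∈ Subgroup.closure (partialConjSet A) := by
    intro k l a hlt
    have := ih _ ?_ (h.mul_partialConj a l) rfl
    · rwa [Subgroup.mul_mem_cancel_right _
        (Subgroup.subset_closure (partialConj_mem l a))] at this
    · rw [← hN]
      refine Finset.sum_lt_sum (fun m _ => ?_) ⟨l, Finset.mem_univ _, by simpa using hlt⟩
      by_cases hm : m = l
      · subst hm
        simpa using hlt.le
      · simp [hm]
  by_cases h1 : ∃ k, EndsIn k (g k)
  · obtain ⟨k, hk⟩ := h1
    obtain ⟨a, t, e⟩ := hk.exists
    refine step k k a⁻¹ ?_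
    have : g k * CoprodI.of a⁻¹ * (g k)⁻¹ * g k = lprod t := by
      rw [inv_mul_cancel_right, ← lprod_nf (g k), e]
      simp
    rw [this]
    refine (len_lprod_le t).trans_lt ?_
    simp [len, e]
  by_cases h2 : ∃ k l, k ≠ l ∧ ∃ (a : A k) (t : _), nf (g l) = nf (g k) ++ ⟨k, a⟩ :: t
  · obtain ⟨k, l, -, a, t, e⟩ := h2
    refine step k l a⁻¹ ?_
    have : g k * CoprodI.of a⁻¹ * (g k)⁻¹ * g l = lprod (nf (g k) ++ t) := by
      rw [← lprod_nf (g l), e]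
      simp [mul_assoc]
    rw [this]
    refine (len_lprod_le _).trans_lt ?_
    simp [len, e]
  · push Not at h1 h2
    rw [h.eq_one h1 h2]
    exact one_mem _

/-- An automorphism that permutes the factors. -/
def IsFactorAut (e : MulAut (CoprodI A)) : Prop :=
  ∃ (σ : Equiv.Perm ι) (α : ∀ k, A k ≃* A (σ k)),
    ∀ (k : ι) (a : A k), e (CoprodI.of a) = CoprodI.of (α k a)

omit [DecidableEq ι] in
theorem IsFactorAut.one : IsFactorAut (1 : MulAut (CoprodI A)) :=
  ⟨1, fun _ => MulEquiv.refl _, fun _ _ => rfl⟩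

omit [DecidableEq ι] in
theorem IsFactorAut.mul {e f : MulAut (CoprodI A)} (he : IsFactorAut e) (hf : IsFactorAut f) :
    IsFactorAut (e * f) := by
  obtain ⟨σ, α, hα⟩ := he
  obtain ⟨τ, β, hβ⟩ := hf
  exact ⟨σ * τ, fun k => (β k).trans (α (τ k)), fun k a => by
    rw [MulAut.mul_apply, hβ, hα]; rfl⟩

theorem IsFactorAut.mul_partialConj {e : MulAut (CoprodI A)} (he : IsFactorAut e) (i : ι) {j : ι}
    (x : A j) : ∃ (k l : ι) (y : A l), e * partialConj i x = partialConj k y * e := by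
  obtain ⟨σ, α, hα⟩ := he
  refine ⟨σ i, σ j, α j x, mulAut_ext fun m a => ?_⟩
  by_cases hm : m = i
  · subst hm
    simp [partialConj_of_self, hα]
  · simp [partialConj_of_ne hm, hα, partialConj_of_ne (σ.injective.ne hm)]

theorem nf_lift_of {σ : Equiv.Perm ι} (α : ∀ k, A k ≃* A (σ k)) (g : CoprodI A) :
    nf (CoprodI.lift (fun k => (CoprodI.of (i := σ k)).comp (α k).toMonoidHom) g : CoprodI A) =
      (nf g).map fun s => ⟨σ s.1, α s.1 s.2⟩ := by
  refine nf_eq ⟨?_, ?_⟩ ?_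
  · simp only [List.mem_map]
    rintro _ ⟨s, hs, rfl⟩
    simpa using (reduced_nf g).1 s hs
  · rw [List.isChain_map]
    exact (reduced_nf g).2.imp fun _ _ h => σ.injective.ne h
  · conv_lhs => rw [← lprod_nf g]
    generalize nf g = l
    induction l with
    | nil => simp
    | cons s l ih =>
      rw [lprod_cons, map_mul, ih, CoprodI.lift_of]
      simp

theorem exists_factorAut (σ : Equiv.Perm ι) (α : ∀ k, A k ≃* A (σ k)) :
    ∃ e : MulAut (CoprodI A), ∀ (k : ι) (a : A k), e (CoprodI.of a) = CoprodI.of (α k a) := by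
  let f : CoprodI A →* CoprodI A :=
    CoprodI.lift fun k => (CoprodI.of (i := σ k)).comp (α k).toMonoidHom
  have hf : Function.Bijective f := by
    constructor
    · rw [injective_iff_map_eq_one]
      intro g hg
      have h1 := nf_lift_of α g
      rw [show CoprodI.lift _ g = f g from rfl, hg, nf_one, eq_comm, List.map_eq_nil_iff] at h1
      exact nf_eq_nil.1 h1
    · rw [← MonoidHom.range_eq_top, eq_top_iff]
      intro g _
      induction g using CoprodI.induction_on with
      | one => exact one_mem _
      | of i m =>
        obtain ⟨k, rfl⟩ := σ.surjective i
        exact ⟨CoprodI.of ((α k).symm m), by simp [f]⟩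
      | mul x y hx hy => exact mul_mem (hx trivial) (hy trivial)
  exact ⟨MulEquiv.ofBijective f hf, fun k a => by simp [f]⟩

theorem finite_isFactorAut [Finite ι] [∀ i, Finite (A i)] :
    {e : MulAut (CoprodI A) | IsFactorAut e}.Finite := by
  let F : (Σ σ : Equiv.Perm ι, ∀ k, A k ≃* A (σ k)) → MulAut (CoprodI A) :=
    fun p => (exists_factorAut p.1 p.2).choose
  have : ∀ k l, Finite (A k ≃* A l) := fun k l => DFunLike.finite _
  refine (Set.finite_range F).subset ?_
  rintro e ⟨σ, α, hα⟩
  refine ⟨⟨σ, α⟩, mulAut_ext fun k a => ?_⟩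
  rw [hα]
  exact (exists_factorAut σ α).choose_spec k a

omit [DecidableEq ι] in
theorem exists_hom_of_conj {K : Type*} [Group K] (ρ : K →* CoprodI A) {g : CoprodI A} {i : ι}
    (h : ∀ x, ∃ a : A i, ρ x = g * CoprodI.of a * g⁻¹) :
    ∃ α : K →* A i, ∀ x, ρ x = g * CoprodI.of (α x) * g⁻¹ := by
  choose α hα using h
  refine ⟨MonoidHom.mk' α fun x y => CoprodI.of_injective i ?_, hα⟩
  have := hα (x * y)
  rw [map_mul, hα, hα] at this
  have h2 : g * (CoprodI.of (α x) * CoprodI.of (α y)) * g⁻¹ = g * CoprodI.of (α (x * y)) * g⁻¹ := by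
    rw [← this]; group
  rw [map_mul]
  exact (mul_left_cancel (mul_right_cancel h2)).symm

/-- Every automorphism of a free product of finite groups is a product of partial conjugations
followed by a permutation of the factors. -/
theorem exists_eq_mul_factorAut [Finite ι] [∀ i, Finite (A i)] [∀ i, Nontrivial (A i)]
    (φ : MulAut (CoprodI A)) :
    ∃ s ∈ Subgroup.closure (partialConjSet A), ∃ e, IsFactorAut e ∧ φ = s * e := by
  rcases isEmpty_or_nonempty ι with hι | hι
  · exact ⟨1, one_mem _, 1, IsFactorAut.one, mulAut_ext fun k => hι.elim k⟩
  -- The image of a finite factor is a finite subgroup, hence conjugate into a factor.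
  have key : ∀ (ψ : MulAut (CoprodI A)) (k : ι), ∃ (g : CoprodI A) (l : ι) (α : A k →* A l),
      ∀ a, ψ (CoprodI.of a) = g * CoprodI.of (α a) * g⁻¹ := by
    intro ψ k
    obtain ⟨g, l, h⟩ := exists_conj_mem_factor (ψ.toMonoidHom.comp (CoprodI.of (i := k)))
    obtain ⟨α, hα⟩ := exists_hom_of_conj _ h
    exact ⟨g, l, α, hα⟩
  choose g σ α hα using key φ
  choose h τ β hβ using key φ⁻¹
  have inj : ∀ {ψ : MulAut (CoprodI A)} {k : ι} {g : CoprodI A} {l : ι} {α : A k →* A l},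
      (∀ a, ψ (CoprodI.of a) = g * CoprodI.of (α a) * g⁻¹) → Function.Injective α := by
    intro ψ k g l α hα
    rw [injective_iff_map_eq_one]
    intro a ha
    have := hα a
    rw [ha, map_one, mul_one, mul_inv_cancel, EmbeddingLike.map_eq_one_iff] at this
    exact CoprodI.of_injective k (by simpa using this)
  -- φ⁻¹ ∘ φ carries a nontrivial element of A k to a conjugate of an element of A (τ (σ k));
  -- malnormality identifies the indices.
  have hτσ : ∀ k, τ (σ k) = k := by
    intro k
    obtain ⟨a, ha⟩ := exists_ne (1 : A k)
    have h1 : (CoprodI.of a : CoprodI A) = φ⁻¹ (φ (CoprodI.of a)) := by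
      rw [← MulAut.mul_apply, inv_mul_cancel, MulAut.one_apply]
    rw [hα, map_mul, map_mul, map_inv, hβ] at h1
    refine (malnormal (a := β (σ k) (α k a)) (b := a) (g := φ⁻¹ (g k) * h (σ k)) ?_ ?_).1
    · rw [Ne, (injective_iff_map_eq_one' _).1 (inj (hβ _)), (injective_iff_map_eq_one' _).1
        (inj (hα _))]
      exact ha
    · rw [h1]; group
  have hσ : Function.Bijective σ :=
    Finite.injective_iff_bijective.1 (Function.LeftInverse.injective hτσ)
  -- A (σ k) embeds back into A (τ (σ k)) = A k, so the finite cardinalities agree.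
  have hbij : ∀ k, Function.Bijective (α k) := by
    intro k
    refine (inj (hα k)).bijective_of_nat_card_le ?_
    have h1 := Nat.card_le_card_of_injective _ (inj (hβ (σ k)))
    rwa [hτσ] at h1
  obtain ⟨e, he⟩ := exists_factorAut (Equiv.ofBijective σ hσ)
    (fun k => MulEquiv.ofBijective (α k) (hbij k))
  have conj : ∀ m, ∃ g' : CoprodI A, ∀ b : A m,
      (φ * e⁻¹) (CoprodI.of b) = g' * CoprodI.of b * g'⁻¹ := by
    intro m
    obtain ⟨k, rfl⟩ := hσ.2 m
    refine ⟨g k, fun b => ?_⟩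
    obtain ⟨a, rfl⟩ := (hbij k).2 b
    rw [← hα]
    have : e (CoprodI.of a) = CoprodI.of (α k a) := he k a
    rw [← this, ← MulAut.mul_apply, inv_mul_cancel_right]
  choose g' hg' using conj
  have hc : IsConjBy (φ * e⁻¹) g' := hg'
  exact ⟨φ * e⁻¹, hc.mem_closure, e, ⟨_, _, he⟩, by simp⟩

variable (A) in
theorem fg_out [Finite ι] [∀ i, Finite (A i)] [∀ i, Nontrivial (A i)] :
    Group.FG (Out (CoprodI A)) := by
  have : Group.FG (MulAut (CoprodI A)) := by
    rw [Group.fg_iff]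
    refine ⟨partialConjSet A ∪ {e | IsFactorAut e}, ?_,
      (Set.finite_range _).union finite_isFactorAut⟩
    rw [eq_top_iff]
    intro φ _
    obtain ⟨s, hs, e, he, rfl⟩ := exists_eq_mul_factorAut φ
    exact mul_mem (Subgroup.closure_mono Set.subset_union_left hs)
      (Subgroup.subset_closure (.inr he))
  infer_instance

end Generators

/-! ### Multiple partial conjugations and the direct sum decomposition -/

section DirectSum

variable {ι : Type*} [DecidableEq ι] {A : ι → Type*} [∀ i, Group (A i)]

/-- The retraction of the free product onto the free product of the factors indexed by `s`. -/
def retr (s : Finset ι) : CoprodI A →* CoprodI A :=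
  CoprodI.lift fun m => if m ∈ s then CoprodI.of else 1

theorem retr_of_mem {s : Finset ι} {m : ι} (h : m ∈ s) (a : A m) :
    retr s (CoprodI.of a) = CoprodI.of a := by simp [retr, h]

theorem retr_of_notMem {s : Finset ι} {m : ι} (h : m ∉ s) (a : A m) :
    retr s (CoprodI.of a) = 1 := by simp [retr, h]

theorem retr_retr_of_subset {s t : Finset ι} (h : s ⊆ t) (x : CoprodI A) :
    retr t (retr s x) = retr s x := by
  have : (retr t).comp (retr s) = (retr s : CoprodI A →* CoprodI A) := by
    refine CoprodI.ext_hom _ _ fun m => MonoidHom.ext fun a => ?_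
    by_cases hm : m ∈ s
    · simp [retr_of_mem hm, retr_of_mem (h hm)]
    · simp [retr_of_notMem hm]
  exact DFunLike.congr_fun this x

/-- A homomorphism that fixes the factors indexed by `s` fixes the image of `retr s`. -/
theorem apply_retr {s : Finset ι} {f : CoprodI A →* CoprodI A}
    (h : ∀ m ∈ s, ∀ a : A m, f (CoprodI.of a) = CoprodI.of a) (x : CoprodI A) :
    f (retr s x) = retr s x := by
  have : f.comp (retr s) = retr s := by
    refine CoprodI.ext_hom _ _ fun m => MonoidHom.ext fun a => ?_
    by_cases hm : m ∈ s
    · simp [retr_of_mem hm, h m hm]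
    · simp [retr_of_notMem hm]
  exact DFunLike.congr_fun this x

/-- The endomorphism of the free product that conjugates `A k` by the inverse of the part of `V k`
in `A i * A j`, for `k ≠ i, j`, and is the identity on `A i` and `A j`. -/
def multiHom (i j : ι) (V : {k : ι // k ≠ i ∧ k ≠ j} → CoprodI A) : CoprodI A →* CoprodI A :=
  CoprodI.lift fun m =>
    if h : m ≠ i ∧ m ≠ j then
      (MulAut.conj (retr {i, j} (V ⟨m, h⟩))⁻¹).toMonoidHom.comp (CoprodI.of (i := m))
    else CoprodI.of

variable {i j : ι}

theorem multiHom_of_mem {m : ι} (h : m ∈ ({i, j} : Finset ι))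
    (V : {k : ι // k ≠ i ∧ k ≠ j} → CoprodI A) (a : A m) :
    multiHom i j V (CoprodI.of a) = CoprodI.of a := by
  have : ¬ (m ≠ i ∧ m ≠ j) := by
    simp only [Finset.mem_insert, Finset.mem_singleton] at h
    tauto
  rw [multiHom, CoprodI.lift_of, dif_neg this]

theorem multiHom_of (k : {k : ι // k ≠ i ∧ k ≠ j}) (V : {k : ι // k ≠ i ∧ k ≠ j} → CoprodI A)
    (a : A k) : multiHom i j V (CoprodI.of a) =
      (retr {i, j} (V k))⁻¹ * CoprodI.of a * retr {i, j} (V k) := by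
  rw [multiHom, CoprodI.lift_of, dif_pos k.2]
  simp

theorem eq_multiHom {V : {k : ι // k ≠ i ∧ k ≠ j} → CoprodI A} {f : CoprodI A →* CoprodI A}
    (h1 : ∀ m ∈ ({i, j} : Finset ι), ∀ a : A m, f (CoprodI.of a) = CoprodI.of a)
    (h2 : ∀ (k : {k : ι // k ≠ i ∧ k ≠ j}) (a : A k), f (CoprodI.of a) =
      (retr {i, j} (V k))⁻¹ * CoprodI.of a * retr {i, j} (V k)) : f = multiHom i j V := by
  refine CoprodI.ext_hom _ _ fun m => MonoidHom.ext fun a => ?_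
  by_cases hm : m ∈ ({i, j} : Finset ι)
  · simp only [MonoidHom.comp_apply]
    rw [h1 m hm, multiHom_of_mem hm]
  · have hm' : m ≠ i ∧ m ≠ j := by simpa using hm
    exact (h2 ⟨m, hm'⟩ a).trans (multiHom_of ⟨m, hm'⟩ V a).symm

theorem multiHom_retr (V : {k : ι // k ≠ i ∧ k ≠ j} → CoprodI A) (x : CoprodI A) :
    multiHom i j V (retr {i, j} x) = retr {i, j} x :=
  apply_retr (fun _ hm a => multiHom_of_mem hm V a) x

/-- The conjugators lie in A i * A j, which these maps fix. Conjugating by inverses makes the order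
of multiplication come out right: w⁻¹v⁻¹ a vw. -/
theorem multiHom_comp (V W : {k : ι // k ≠ i ∧ k ≠ j} → CoprodI A) :
    (multiHom i j V).comp (multiHom i j W) = multiHom i j (V * W) := by
  refine eq_multiHom (fun m hm a => ?_) fun k a => ?_
  · simp [multiHom_of_mem hm]
  · simp [multiHom_of, multiHom_retr, mul_assoc]

theorem multiHom_one : multiHom i j (1 : {k : ι // k ≠ i ∧ k ≠ j} → CoprodI A) =
    MonoidHom.id _ :=
  (eq_multiHom (fun _ _ _ => rfl) fun k a => by simp).symm

variable (A i j) in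
/-- The automorphisms `multiHom i j V` as a homomorphism. -/
def multiConj : ({k : ι // k ≠ i ∧ k ≠ j} → CoprodI A) →* MulAut (CoprodI A) :=
  MonoidHom.mk' (fun V => MonoidHom.toMulEquiv (multiHom i j V) (multiHom i j V⁻¹)
    (by rw [multiHom_comp, inv_mul_cancel, multiHom_one])
    (by rw [multiHom_comp, mul_inv_cancel, multiHom_one]))
    fun V W => MulEquiv.ext fun x => (DFunLike.congr_fun (multiHom_comp V W) x).symm

theorem multiConj_apply (V : {k : ι // k ≠ i ∧ k ≠ j} → CoprodI A) (x : CoprodI A) :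
    multiConj A i j V x = multiHom i j V x := rfl

theorem multiConj_mulSingle_of {m : ι} (hm : m ∈ ({i, j} : Finset ι))
    (k : {k : ι // k ≠ i ∧ k ≠ j}) (x : A m) :
    multiConj A i j (Pi.mulSingle k (CoprodI.of x)) = partialConj k.1 x⁻¹ := by
  refine MulEquiv.ext fun y => ?_
  rw [multiConj_apply, partialConj_apply]
  refine (DFunLike.congr_fun (eq_multiHom (fun n hn a => ?_) fun l a => ?_) y).symm
  · refine partialConjHom_of_ne ?_ _ _
    rintro rfl
    simp only [Finset.mem_insert, Finset.mem_singleton] at hn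
    exact hn.elim k.2.1 k.2.2
  · by_cases hl : l = k
    · subst hl
      simp [partialConjHom_of_self, retr_of_mem hm]
    · rw [partialConjHom_of_ne (fun e => hl (Subtype.ext e)), Pi.mulSingle_eq_of_ne hl]
      simp

theorem multiConj_mulSingle_of_notMem {m : ι} (hm : m ∉ ({i, j} : Finset ι))
    (k : {k : ι // k ≠ i ∧ k ≠ j}) (x : A m) :
    multiConj A i j (Pi.mulSingle k (CoprodI.of x)) = 1 := by
  refine MulEquiv.ext fun y => ?_
  rw [multiConj_apply, MulAut.one_apply, ← MonoidHom.id_apply (CoprodI A) y]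
  refine (DFunLike.congr_fun (eq_multiHom (fun n hn a => rfl) fun l a => ?_) _).symm
  by_cases hl : l = k
  · subst hl
    simp [retr_of_notMem hm]
  · simp [Pi.mulSingle_eq_of_ne hl]

variable (A i j) in
/-- The outer automorphisms represented by multiple partial conjugations. -/
def outerMulti : ({k : ι // k ≠ i ∧ k ≠ j} → CoprodI A) →* Out (CoprodI A) :=
  (QuotientGroup.mk' _).comp (multiConj A i j)

/-- If a multiple partial conjugation is inner then it is trivial. -/
theorem retr_eq_one_of_outerMulti_eq_one [∀ i, Nontrivial (A i)] (hij : i ≠ j)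
    {V : {k : ι // k ≠ i ∧ k ≠ j} → CoprodI A} (h : outerMulti A i j V = 1)
    (k : {k : ι // k ≠ i ∧ k ≠ j}) : retr {i, j} (V k) = 1 := by
  obtain ⟨g, hg⟩ := (QuotientGroup.eq_one_iff _).1 h
  have hV : ∀ x, multiHom i j V x = g * x * g⁻¹ := fun x => by
    rw [← multiConj_apply, ← hg, MulAut.conj_apply]
  -- Conjugation by g fixes A i and A j pointwise, so g lies in both.
  have fix : ∀ m ∈ ({i, j} : Finset ι), ∃ c : A m, g = CoprodI.of c := by
    intro m hm
    obtain ⟨a, ha⟩ := exists_ne (1 : A m)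
    exact (malnormal ha ((hV _).symm.trans (multiHom_of_mem hm V a))).2
  obtain ⟨c, hc⟩ := fix i (by simp)
  obtain ⟨d, hd⟩ := fix j (by simp)
  have hg1 : g = 1 := by
    by_contra hne
    have hc1 : c ≠ 1 := by
      rintro rfl
      exact hne (by simpa using hc)
    exact hij (malnormal (g := 1) hc1 (by rw [← hc, one_mul, inv_one, mul_one, hd])).1
  subst hg1
  -- With g = 1, the conjugator commutes with A k, hence lies in A k; but `retr {i, j}` fixes the
  -- conjugator and kills A k.
  obtain ⟨a, ha⟩ := exists_ne (1 : A k)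
  have h1 := hV (CoprodI.of a)
  rw [multiHom_of, one_mul, inv_one, mul_one] at h1
  obtain ⟨b, hb⟩ := (malnormal (g := (retr {i, j} (V k))⁻¹) ha (by rwa [inv_inv])).2
  have h2 := retr_retr_of_subset subset_rfl (V k) (s := {i, j})
  rw [inv_eq_iff_eq_inv, ← map_inv] at hb
  rw [hb, retr_of_notMem (by simpa using k.2)] at h2
  rw [hb, ← h2]

/-- The embedding of `A j` in the outer automorphism group as `H i j`. -/
def toH {i j : ι} (h : j ≠ i) : A j →* H A i j :=
  MonoidHom.mk' (fun x => ⟨outerPartialConj i x⁻¹, x⁻¹, rfl⟩) fun x y => Subtype.ext <| by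
    refine congrArg QuotientGroup.mk (MulEquiv.ext fun g => ?_)
    have := DFunLike.congr_fun (partialConjHom_comp h x⁻¹ y⁻¹) g
    rw [← mul_inv_rev] at this
    exact this.symm

theorem toH_surjective {i j : ι} (h : j ≠ i) : Function.Surjective (toH (A := A) h) := by
  rintro ⟨_, x, rfl⟩
  exact ⟨x⁻¹, Subtype.ext (by simp [toH])⟩

/-- Transport of a homomorphism along an equality of indices. -/
def castHom {P : Type*} [Monoid P] {i m : ι} (h : m = i) (f : A i →* P) : A m →* P := h ▸ f

variable (A) in
/-- The quotient map from the free product onto the free product of `H k i` and `H k j`. -/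
def toCoprod (k : {k : ι // k ≠ i ∧ k ≠ j}) :
    CoprodI A →* Monoid.Coprod (H A k i) (H A k j) :=
  CoprodI.lift fun m =>
    if h : m = i then castHom h (Coprod.inl.comp (toH k.2.1.symm))
    else if h : m = j then castHom h (Coprod.inr.comp (toH k.2.2.symm))
    else 1

theorem toCoprod_of_left (k : {k : ι // k ≠ i ∧ k ≠ j}) (x : A i) :
    toCoprod A k (CoprodI.of x) = Coprod.inl (toH k.2.1.symm x) := by
  simp [toCoprod, castHom]

theorem toCoprod_of_right (hij : i ≠ j) (k : {k : ι // k ≠ i ∧ k ≠ j}) (x : A j) :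
    toCoprod A k (CoprodI.of x) = Coprod.inr (toH k.2.2.symm x) := by
  simp [toCoprod, castHom, hij.symm]

theorem toCoprod_of_notMem (k : {k : ι // k ≠ i ∧ k ≠ j}) {m : ι}
    (hm : m ∉ ({i, j} : Finset ι)) (x : A m) : toCoprod A k (CoprodI.of x) = 1 := by
  simp only [Finset.mem_insert, Finset.mem_singleton, not_or] at hm
  simp [toCoprod, hm.1, hm.2]

theorem toCoprod_retr (k : {k : ι // k ≠ i ∧ k ≠ j}) (V : CoprodI A) :
    toCoprod A k (retr {i, j} V) = toCoprod A k V := by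
  have : (toCoprod A k).comp (retr {i, j}) = toCoprod A k := by
    refine CoprodI.ext_hom _ _ fun m => MonoidHom.ext fun a => ?_
    by_cases hm : m ∈ ({i, j} : Finset ι)
    · simp [retr_of_mem hm]
    · simp [retr_of_notMem hm, toCoprod_of_notMem k hm]
  exact DFunLike.congr_fun this V

theorem toCoprod_surjective (hij : i ≠ j) (k : {k : ι // k ≠ i ∧ k ≠ j}) :
    Function.Surjective (toCoprod A k) := by
  rw [← MonoidHom.range_eq_top, eq_top_iff, ← Coprod.range_inl_sup_range_inr]
  refine sup_le ?_ ?_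
  · rintro _ ⟨w, rfl⟩
    obtain ⟨x, rfl⟩ := toH_surjective k.2.1.symm w
    exact ⟨_, toCoprod_of_left k x⟩
  · rintro _ ⟨w, rfl⟩
    obtain ⟨x, rfl⟩ := toH_surjective k.2.2.symm w
    exact ⟨_, toCoprod_of_right hij k x⟩

variable (A) in
/-- The homomorphism from the free product of `H k i` and `H k j` induced by the inclusions. -/
abbrev coprodToOut (k : {k : ι // k ≠ i ∧ k ≠ j}) :
    Monoid.Coprod (H A k i) (H A k j) →* Out (CoprodI A) :=
  Coprod.lift (H A k i).subtype (H A k j).subtype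

/-- Represents elements of the external free product by elements of the whole free product, so that
facts about `outerMulti` transfer. -/
theorem coprodToOut_toCoprod (hij : i ≠ j) (k : {k : ι // k ≠ i ∧ k ≠ j}) (V : CoprodI A) :
    coprodToOut A k (toCoprod A k V) = outerMulti A i j (Pi.mulSingle k V) := by
  have : (coprodToOut A k).comp (toCoprod A k) =
      (outerMulti A i j).comp (MonoidHom.mulSingle _ k) := by
    refine CoprodI.ext_hom _ _ fun m => MonoidHom.ext fun a => ?_
    simp only [MonoidHom.comp_apply, MonoidHom.mulSingle_apply, outerMulti]
    by_cases hm : m ∈ ({i, j} : Finset ι)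
    · rw [multiConj_mulSingle_of hm]
      simp only [Finset.mem_insert, Finset.mem_singleton] at hm
      rcases hm with rfl | rfl
      · rw [toCoprod_of_left, Coprod.lift_apply_inl]
        rfl
      · rw [toCoprod_of_right hij, Coprod.lift_apply_inr]
        rfl
    · rw [multiConj_mulSingle_of_notMem hm, toCoprod_of_notMem k hm, map_one, map_one]
  exact DFunLike.congr_fun this V

/-- Both elements are images under `outerMulti` of elements supported in different coordinates of a
product group. -/
theorem coprodToOut_commute (hij : i ≠ j) : Pairwise fun k l : {k : ι // k ≠ i ∧ k ≠ j} =>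
    ∀ x y, Commute (coprodToOut A k x) (coprodToOut A l y) := by
  intro k l hkl x y
  obtain ⟨V, rfl⟩ := toCoprod_surjective hij k x
  obtain ⟨W, rfl⟩ := toCoprod_surjective hij l y
  rw [coprodToOut_toCoprod hij, coprodToOut_toCoprod hij]
  have h : Commute (Pi.mulSingle k V : {k : ι // k ≠ i ∧ k ≠ j} → CoprodI A)
      (Pi.mulSingle l W) := Pi.mulSingle_commute (f := fun _ => CoprodI A) hkl V W
  exact h.map (outerMulti A i j)

theorem noncommPiCoprod_toCoprod [Fintype ι] (hij : i ≠ j)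
    (V : {k : ι // k ≠ i ∧ k ≠ j} → CoprodI A) :
    MonoidHom.noncommPiCoprod (coprodToOut A) (coprodToOut_commute hij)
      (fun k => toCoprod A k (V k)) = outerMulti A i j V := by
  have : (MonoidHom.noncommPiCoprod (coprodToOut A) (coprodToOut_commute hij)).comp
      (MonoidHom.pi fun k => (toCoprod A k).comp (Pi.evalMonoidHom _ k)) = outerMulti A i j := by
    refine MonoidHom.pi_ext fun k W => ?_
    rw [← coprodToOut_toCoprod hij, MonoidHom.comp_apply,
      ← MonoidHom.noncommPiCoprod_mulSingle (coprodToOut A) (hcomm := coprodToOut_commute hij)]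
    congr 1
    funext l
    exact Pi.apply_mulSingle (fun l => toCoprod A l) (fun _ => map_one _) k W l
  exact DFunLike.congr_fun this V

theorem noncommPiCoprod_range_eq [Fintype ι] (hij : i ≠ j) :
    (MonoidHom.noncommPiCoprod (coprodToOut A) (coprodToOut_commute hij)).range = HH A i j := by
  rw [MonoidHom.noncommPiCoprod_range, HH]
  refine iSup_congr fun k => ?_
  rw [Coprod.range_lift, Subgroup.range_subtype, Subgroup.range_subtype]

/-- Lift the argument to a family V. Triviality in Out kills each `retr {i, j} (V k)`, and
`toCoprod` sees only that part of V k. -/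
theorem noncommPiCoprod_injective [Fintype ι] [∀ i, Nontrivial (A i)] (hij : i ≠ j) :
    Function.Injective
      (MonoidHom.noncommPiCoprod (coprodToOut A) (coprodToOut_commute hij)) := by
  rw [injective_iff_map_eq_one]
  intro w hw
  choose V hV using fun k => toCoprod_surjective hij k (w k)
  obtain rfl : (fun k => toCoprod A k (V k)) = w := funext hV
  rw [noncommPiCoprod_toCoprod hij] at hw
  funext k
  rw [← toCoprod_retr, retr_eq_one_of_outerMulti_eq_one hij hw, map_one, Pi.one_apply]

variable (A) in
theorem hhIsDirectSum [Finite ι] [∀ i, Nontrivial (A i)] (hij : i ≠ j) : HHIsDirectSum A i j := by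
  have := Fintype.ofFinite ι
  refine ⟨(MonoidHom.ofInjective (noncommPiCoprod_injective hij)).trans
    (MulEquiv.subgroupCongr (noncommPiCoprod_range_eq hij)), fun k w => ?_⟩
  exact MonoidHom.noncommPiCoprod_mulSingle (coprodToOut A) (hcomm := coprodToOut_commute hij) k w

variable (A) in
theorem range_outerMulti [Finite ι] (hij : i ≠ j) : (outerMulti A i j).range = HH A i j := by
  have := Fintype.ofFinite ι
  rw [← noncommPiCoprod_range_eq hij]
  ext x
  constructor
  · rintro ⟨V, rfl⟩
    exact ⟨_, noncommPiCoprod_toCoprod hij V⟩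
  · rintro ⟨w, rfl⟩
    choose V hV using fun k => toCoprod_surjective hij k (w k)
    exact ⟨V, by rw [← noncommPiCoprod_toCoprod hij, funext hV]⟩

end DirectSum

/-! ### Ping-pong on three factors -/

section PingPong

variable {ι : Type*} [DecidableEq ι] {A : ι → Type*} [∀ i, Group (A i)]

theorem fst_mem_nf_of_mul {s : Finset ι} {p : ι} (hp : p ∈ s) (a : A p) {g : CoprodI A}
    (hg : ∀ t ∈ nf g, t.1 ∈ s) : ∀ t ∈ nf (CoprodI.of a * g), t.1 ∈ s := by
  obtain ⟨b, y, rfl, hy⟩ := exists_eq_of_mul p g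
  have key : ∀ t ∈ nf y, t.1 ∈ s := by
    intro t ht
    by_cases hb : b = 1
    · exact hg t (by simpa [hb] using ht)
    · exact hg t (by rw [nf_of_mul hb hy]; exact List.mem_cons_of_mem _ ht)
  rw [← mul_assoc, ← map_mul]
  by_cases hab : a * b = 1
  · simpa [hab] using key
  · rw [nf_of_mul hab hy]
    simpa [hp] using key

theorem fst_mem_nf_retr (s : Finset ι) (g : CoprodI A) : ∀ t ∈ nf (retr s g), t.1 ∈ s := by
  induction g using CoprodI.induction_left with
  | one => simp
  | mul a x ih =>
    rename_i m
    rw [map_mul]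
    by_cases hm : m ∈ s
    · rw [retr_of_mem hm]
      exact fst_mem_nf_of_mul hm a ih
    · rwa [retr_of_notMem hm, one_mul]

theorem not_startsIn_of_nf {p q : ι} (hpq : p ≠ q) {g : CoprodI A} {a : A p}
    {t : List (Σ i, A i)} (h : nf g = ⟨p, a⟩ :: t) : ¬ StartsIn q g :=
  fun hq => hpq ((startsIn_of_nf h).eq hq)

/-- The heads of an element and of a reduced continuation of it agree. -/
theorem hd_inv_eq {p q : ι} (hpq : p ≠ q) {P Q : CoprodI A} (h : hd p P ≠ hd p Q) :
    hd q P⁻¹ = hd q (P⁻¹ * Q) := by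
  obtain ⟨x, hx, hx'⟩ := exists_eq_hd_mul p P
  obtain ⟨y, hy, hy'⟩ := exists_eq_hd_mul p Q
  generalize hd p P = a at *
  generalize hd p Q = b at *
  subst hx hy
  have hc : a⁻¹ * b ≠ 1 := fun e => h (inv_mul_eq_one.1 e)
  have e1 : (CoprodI.of a * x)⁻¹ = x⁻¹ * CoprodI.of a⁻¹ := by simp
  have e2 : (CoprodI.of a * x)⁻¹ * (CoprodI.of b * y) = x⁻¹ * (CoprodI.of (a⁻¹ * b) * y) := by
    simp [mul_assoc]
  rw [e2, e1]
  have n2 := nf_of_mul hc hy'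
  -- P⁻¹ Q = x⁻¹ (a⁻¹b) y is reduced at x⁻¹. If x ≠ 1, it shares its first letter with P⁻¹; if x =
  -- 1, neither element starts in A q and both heads are 1.
  by_cases hx1 : x = 1
  · subst hx1
    rw [inv_one, one_mul, one_mul, hd_of_not_startsIn (not_startsIn_of_nf hpq n2)]
    refine hd_of_not_startsIn ?_
    by_cases ha : a⁻¹ = 1
    · rw [ha, map_one]
      exact not_startsIn_one q
    · exact not_startsIn_of_nf hpq (nf_of ha)
  · have hne : nf x⁻¹ ≠ [] := by
      rw [Ne, nf_eq_nil, inv_eq_one]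
      exact hx1
    have key : ∀ z : CoprodI A, (∀ r, StartsIn r z → r = p) →
        (nf (x⁻¹ * z)).head? = (nf x⁻¹).head? := by
      intro z hz
      rw [nf_mul, List.head?_append_of_ne_nil _ hne]
      intro r hr hr'
      obtain rfl := hz r hr'
      exact hx' (endsIn_inv.1 hr)
    refine hd_congr ?_
    rw [key, key]
    · intro r hr
      exact hr.eq (startsIn_of_nf n2)
    · intro r hr
      by_cases ha : a⁻¹ = 1
      · rw [ha, map_one] at hr
        exact absurd hr (not_startsIn_one r)
      · exact hr.eq (startsIn_of_nf (nf_of ha))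

/-- The paths from the coset `g p * A p` to the cosets `g q * A q` and `g r * A r` diverge at their
start. -/
def Diverge (g : ι → CoprodI A) (p q r : ι) : Prop :=
  hd p ((g p)⁻¹ * g q) ≠ hd p ((g p)⁻¹ * g r)

theorem Diverge.symm {g : ι → CoprodI A} {p q r : ι} (h : Diverge g p q r) : Diverge g p r q :=
  Ne.symm h

/-- If the paths from p towards q and r part at p, then p lies between q and r, so from q both p and
r are seen in the same direction. -/
theorem Diverge.not_diverge {g : ι → CoprodI A} {p q r : ι} (hpq : p ≠ q)
    (h : Diverge g p q r) : ¬ Diverge g q p r := by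
  intro h'
  have := hd_inv_eq hpq h
  rw [mul_inv_rev, inv_inv, mul_assoc, mul_inv_cancel_left] at this
  exact h' this

/-- The conjugate of x by g p rotates the branch towards r about the coset of p, multiplying its
initial direction by x while that of q stays put. -/
theorem diverge_update {g : ι → CoprodI A} {p q r : ι} (hpr : p ≠ r) (hqr : q ≠ r)
    {x : A p} (hx : x ≠ 1) (h : ¬ Diverge g p q r) :
    Diverge (Function.update g r (g p * CoprodI.of x * (g p)⁻¹ * g r)) p q r := by
  rw [Diverge, not_not] at h
  rw [Diverge, Function.update_of_ne hpr, Function.update_of_ne hqr, Function.update_self, h]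
  simp only [mul_assoc, inv_mul_cancel_left, hd_of_mul]
  simpa using hx

/-- The homomorphism by which `A m` acts by inverse conjugation on the factor `A r`. -/
def twist {r m : ι} (h : m ≠ r) : A m →* MulAut (CoprodI A) :=
  MonoidHom.mk' (fun x => partialConj r x⁻¹) fun x y => MulEquiv.ext fun g => by
    have := DFunLike.congr_fun (partialConjHom_comp h x⁻¹ y⁻¹) g
    rw [← mul_inv_rev] at this
    exact this.symm

theorem ite_ne_self {i k : ι} (hik : i ≠ k) (m : ι) : m ≠ if m = k then i else k := by
  split_ifs with h
  · rw [h]; exact hik.symm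
  · exact h

/-- The action of the free product on itself in which all factors but `A k` twist the factor `A k`
and the factor `A k` twists the factor `A i`. -/
def triTwist {i k : ι} (hik : i ≠ k) : CoprodI A →* MulAut (CoprodI A) :=
  CoprodI.lift fun m => twist (ite_ne_self hik m)

theorem triTwist_of {i k : ι} (hik : i ≠ k) {m : ι} (x : A m) :
    triTwist hik (CoprodI.of x) = partialConj (if m = k then i else k) x⁻¹ := by
  simp [triTwist, twist]

/-- Ping-pong invariant: after a word whose last letter lies in A p, the coset of p lies between the
other two. -/
theorem exists_isConjBy_triTwist {i j k : ι} (hik : i ≠ k)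
    (v : List (Σ i, A i)) (hv : Reduced v) (hs : ∀ t ∈ v, t.1 ∈ ({i, j, k} : Finset ι)) :
    ∃ g : ι → CoprodI A, IsConjBy (triTwist hik (lprod v)) g ∧ (v = [] → g = 1) ∧
      ∀ t ∈ v.getLast?, ∀ q ∈ ({i, j, k} : Finset ι), ∀ r ∈ ({i, j, k} : Finset ι),
        t.1 ≠ q → t.1 ≠ r → q ≠ r → Diverge g t.1 q r := by
  induction v using List.reverseRecOn with
  | nil => exact ⟨1, fun m a => by simp, fun _ => rfl, by simp⟩
  | append_singleton u s ih =>
    obtain ⟨p, x⟩ := s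
    obtain ⟨hu, hx, hne⟩ := reduced_append.1 hv
    have hx1 : x ≠ 1 := (reduced_cons.1 hx).1
    have hp : p ∈ ({i, j, k} : Finset ι) := hs ⟨p, x⟩ (by simp)
    obtain ⟨g, hg, hg1, hg2⟩ := ih hu fun t ht => hs t (List.mem_append_left _ ht)
    set r := if p = k then i else k with hr
    have hrs : r ∈ ({i, j, k} : Finset ι) := by
      rw [hr]; split_ifs <;> simp
    have hpr : p ≠ r := ite_ne_self hik p
    have three : ∀ q ∈ ({i, j, k} : Finset ι), ∀ m ∈ ({i, j, k} : Finset ι),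
        q ≠ p → q ≠ r → m ≠ p → m = q ∨ m = r := by
      intro q hq m hm h1 h2 h3
      simp only [Finset.mem_insert, Finset.mem_singleton] at hp hq hm hrs
      grind
    -- Before the new letter, the middle coset belongs to the preceding letter's factor, which is
    -- not p; so there is no divergence at p. For an empty prefix all conjugators are 1.
    have main : ∀ q ∈ ({i, j, k} : Finset ι), p ≠ q → q ≠ r → ¬ Diverge g p q r := by
      intro q hq hpq hqr
      rcases hul : u.getLast? with _ | t
      · rw [List.getLast?_eq_none_iff] at hul
        simp [Diverge, hg1 hul]
      · have htp : t.1 ≠ p := hne t hul ⟨p, x⟩ rfl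
        have hts := hs t (List.mem_append_left _ (List.mem_of_getLast? hul))
        have hD := hg2 t hul
        rcases three q hq t.1 hts hpq.symm hqr htp with e | e
        · rw [e] at hD
          exact (hD p hp r hrs hpq.symm hqr hpr).not_diverge hpq.symm
        · rw [e] at hD
          exact fun h => (hD p hp q hq hpr.symm hqr.symm hpq).not_diverge hpr.symm h.symm
    refine ⟨Function.update g r (g p * CoprodI.of x⁻¹ * (g p)⁻¹ * g r), ?_, by simp, ?_⟩
    · rw [lprod_append, map_mul, lprod_cons, lprod_nil, mul_one, triTwist_of]
      exact hg.mul_partialConj x⁻¹ r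
    · intro t ht q hq q' hq' h1 h2 h3
      obtain rfl : (⟨p, x⟩ : Σ i, A i) = t := by simpa using ht
      have hxi : x⁻¹ ≠ 1 := inv_ne_one.2 hx1
      by_cases hqr : q = r
      · subst hqr
        exact (diverge_update hpr h3.symm hxi (main q' hq' h2 h3.symm)).symm
      · obtain rfl : q' = r :=
          (three q hq q' hq' h1.symm hqr h2.symm).resolve_left h3.symm
        exact diverge_update hpr hqr hxi (main q hq h1 hqr)

/-- A product of twists which preserves three factors up to a common conjugation is trivial. -/
theorem eq_one_of_triTwist [∀ i, Nontrivial (A i)] {i j k : ι} (hij : i ≠ j) (hik : i ≠ k)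
    (hjk : j ≠ k) {V : CoprodI A} (hV : retr {i, j, k} V = V) {c : CoprodI A}
    (h : ∀ m ∈ ({i, j, k} : Finset ι), ∀ a : A m, ∃ b : A m,
      triTwist hik V (CoprodI.of a) = c * CoprodI.of b * c⁻¹) : V = 1 := by
  obtain ⟨g, hg, -, hD⟩ := exists_isConjBy_triTwist (j := j) hik (nf V) (reduced_nf V)
    (by rw [← hV]; exact fst_mem_nf_retr _ V)
  rw [lprod_nf] at hg
  -- By malnormality, c⁻¹ (g m) lies in A m.
  have hd' : ∀ m ∈ ({i, j, k} : Finset ι), ∃ d : A m, g m = c * CoprodI.of d := by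
    intro m hm
    obtain ⟨a, ha⟩ := exists_ne (1 : A m)
    obtain ⟨b, hb⟩ := h m hm a
    rw [hg m a] at hb
    obtain ⟨d, hd⟩ := (malnormal (g := c⁻¹ * g m) (b := b) ha (by
      have : c⁻¹ * g m * CoprodI.of a * (c⁻¹ * g m)⁻¹ =
        c⁻¹ * (g m * CoprodI.of a * (g m)⁻¹) * c := by group
      rw [this, hb]; group)).2
    exact ⟨d, by rw [← hd, mul_inv_cancel_left]⟩
  by_contra hne
  have hnil : nf V ≠ [] := fun e => hne (nf_eq_nil.1 e)
  obtain ⟨t, ht⟩ : ∃ t, (nf V).getLast? = some t := ⟨_, List.getLast?_eq_some_getLast hnil⟩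
  have hp : t.1 ∈ ({i, j, k} : Finset ι) := by
    refine fst_mem_nf_retr _ V t ?_
    rw [hV]
    exact List.mem_of_getLast? ht
  obtain ⟨q, hq, r, hr, h1, h2, h3⟩ : ∃ q ∈ ({i, j, k} : Finset ι),
      ∃ r ∈ ({i, j, k} : Finset ι), t.1 ≠ q ∧ t.1 ≠ r ∧ q ≠ r := by
    simp only [Finset.mem_insert, Finset.mem_singleton] at hp ⊢
    rcases hp with e | e | e <;> rw [e]
    · exact ⟨j, by simp, k, by simp, hij, hik, hjk⟩
    · exact ⟨i, by simp, k, by simp, hij.symm, hjk, hik⟩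
    · exact ⟨i, by simp, j, by simp, hik.symm, hjk.symm, hij⟩
  -- Hence from the coset of the last letter's factor the other two cosets lie in the same direction
  -- d⁻¹, contradicting the ping-pong invariant.
  have key : ∀ q ∈ ({i, j, k} : Finset ι), t.1 ≠ q → ∀ d : A t.1, g t.1 = c * CoprodI.of d →
      hd t.1 ((g t.1)⁻¹ * g q) = d⁻¹ := by
    intro q hq hne d hd
    obtain ⟨e, he⟩ := hd' q hq
    have : (g t.1)⁻¹ * g q = CoprodI.of d⁻¹ * CoprodI.of e := by
      rw [hd, he, map_inv]; group
    rw [this, hd_of_mul, hd_of_not_startsIn, mul_one]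
    by_cases he1 : e = 1
    · rw [he1, map_one]
      exact not_startsIn_one _
    · exact not_startsIn_of_nf hne.symm (nf_of he1)
  obtain ⟨d, hd⟩ := hd' t.1 hp
  exact hD t ht q hq r hr h1 h2 h3 ((key q hq h1 d hd).trans (key r hr h2 d hd).symm)

end PingPong

/-! ### Products of partial conjugations on three factors -/

section ThreeFactors

variable {ι : Type*} [DecidableEq ι] {A : ι → Type*} [∀ i, Group (A i)]

/-- An automorphism that preserves every factor. -/
def IsFactorwise (e : MulAut (CoprodI A)) : Prop :=
  ∀ (k : ι) (a : A k), ∃ b : A k, e (CoprodI.of a) = CoprodI.of b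

omit [DecidableEq ι] in
theorem IsFactorwise.one : IsFactorwise (1 : MulAut (CoprodI A)) := fun _ a => ⟨a, rfl⟩

omit [DecidableEq ι] in
theorem IsFactorwise.mul {e f : MulAut (CoprodI A)} (he : IsFactorwise e) (hf : IsFactorwise f) :
    IsFactorwise (e * f) := by
  intro k a
  obtain ⟨b, hb⟩ := hf k a
  obtain ⟨c, hc⟩ := he k b
  exact ⟨c, by rw [MulAut.mul_apply, hb, hc]⟩

theorem IsFactorwise.partialConj_self {m : ι} (y : A m) : IsFactorwise (partialConj m y) := by
  intro k a
  by_cases hk : k = m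
  · subst hk
    exact ⟨y * a * y⁻¹, by simp [partialConj_of_self]⟩
  · exact ⟨a, partialConj_of_ne hk y a⟩

theorem IsFactorwise.retr_apply {e : MulAut (CoprodI A)} (he : IsFactorwise e) (s : Finset ι)
    (x : CoprodI A) : retr s (e x) = e (retr s x) := by
  have : (retr s).comp e.toMonoidHom = e.toMonoidHom.comp (retr s) := by
    refine CoprodI.ext_hom _ _ fun m => MonoidHom.ext fun a => ?_
    obtain ⟨b, hb⟩ := he m a
    by_cases hm : m ∈ s
    · simp [hb, retr_of_mem hm]
    · simp [hb, retr_of_notMem hm]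
  exact DFunLike.congr_fun this x

theorem IsFactorwise.exists_apply_partialConj {e : MulAut (CoprodI A)} (he : IsFactorwise e)
    {m l : ι} (y : A l) : ∃ y' : A l, ∀ x, e (partialConj m y x) = partialConj m y' (e x) := by
  obtain ⟨y', hy'⟩ := he l y
  refine ⟨y', fun x => ?_⟩
  have : e * partialConj m y = partialConj m y' * e := by
    refine mulAut_ext fun k a => ?_
    obtain ⟨b, hb⟩ := he k a
    by_cases hk : k = m
    · subst hk
      simp [partialConj_of_self, hb, hy']
    · simp [partialConj_of_ne hk, hb]
  exact DFunLike.congr_fun this x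

/-- Conjugating by y and undoing this on A r and on A p leaves only the twist of A q. The correction
on A p is an automorphism of that factor. -/
theorem partialConj_retr_eq {s : Finset ι} {p q r : ι} (hpq : p ≠ q) (hpr : p ≠ r) (hqr : q ≠ r)
    (hs : ∀ m ∈ s, m = p ∨ m = q ∨ m = r) (y : A p) (x : CoprodI A) :
    partialConj q y (retr s x) = CoprodI.of y *
      partialConj r y⁻¹ (partialConj p y⁻¹ (retr s x)) * (CoprodI.of y)⁻¹ := by
  have : (partialConj q y).toMonoidHom.comp (retr s) =
      (MulAut.conj (CoprodI.of y) * partialConj r y⁻¹ * partialConj p y⁻¹).toMonoidHom.comp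
        (retr s) := by
    refine CoprodI.ext_hom _ _ fun m => MonoidHom.ext fun a => ?_
    by_cases hm : m ∈ s
    · rcases hs m hm with rfl | rfl | rfl
      · simp [retr_of_mem hm, partialConj_of_self, partialConj_of_ne hpq, partialConj_of_ne hpr,
          mul_assoc]
      · simp [retr_of_mem hm, partialConj_of_self, partialConj_of_ne hpq.symm,
          partialConj_of_ne hqr]
      · simp [retr_of_mem hm, partialConj_of_self, partialConj_of_ne hpr.symm,
          partialConj_of_ne hqr.symm, mul_assoc]
    · simp [retr_of_notMem hm]
  exact DFunLike.congr_fun this x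

theorem retr_partialConj {s : Finset ι} {m l : ι} (hm : m ∈ s) (hl : l ∈ s) (y : A l)
    (x : CoprodI A) : retr s (partialConj m y x) = partialConj m y (retr s x) := by
  have : (retr s).comp (partialConj m y).toMonoidHom =
      (partialConj m y).toMonoidHom.comp (retr s) := by
    refine CoprodI.ext_hom _ _ fun k => MonoidHom.ext fun a => ?_
    by_cases hk : k = m
    · subst hk
      simp [partialConj_of_self, retr_of_mem hm, retr_of_mem hl]
    · by_cases hks : k ∈ s
      · simp [partialConj_of_ne hk, retr_of_mem hks]
      · simp [partialConj_of_ne hk, retr_of_notMem hks]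
  exact DFunLike.congr_fun this x

/-- Either the conjugated factor or the conjugating letter is killed by the retraction. -/
theorem retr_partialConj_of_not {s : Finset ι} {m l : ι} (h : ¬ (m ∈ s ∧ l ∈ s)) (y : A l)
    (x : CoprodI A) : retr s (partialConj m y x) = retr s x := by
  have : (retr s).comp (partialConj m y).toMonoidHom = retr s := by
    refine CoprodI.ext_hom _ _ fun k => MonoidHom.ext fun a => ?_
    by_cases hk : k = m
    · subst hk
      by_cases hl : l ∈ s
      · simp [partialConj_of_self, retr_of_notMem (fun hm => h ⟨hm, hl⟩)]
      · simp [partialConj_of_self, retr_of_notMem hl]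
    · simp [partialConj_of_ne hk]
  exact DFunLike.congr_fun this x

variable {i j k : ι}

/-- A partial conjugation of a factor by itself is factorwise, one on the chosen target is a single
twist, and one on the remaining factor becomes such a twist by `partialConj_retr_eq`. -/
theorem exists_partialConj_retr_eq (hik : i ≠ k) {m l : ι} (hm : m ∈ ({i, j, k} : Finset ι))
    (hl : l ∈ ({i, j, k} : Finset ι)) (y : A l) :
    ∃ (c u : CoprodI A) (e : MulAut (CoprodI A)), len u ≤ 1 ∧ retr {i, j, k} u = u ∧
      IsFactorwise e ∧ ∀ x, partialConj m y (retr {i, j, k} x) =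
        c * triTwist hik u (e (retr {i, j, k} x)) * c⁻¹ := by
  by_cases hlm : l = m
  · subst hlm
    exact ⟨1, 1, partialConj l y, by simp, by simp, .partialConj_self y, fun x => by simp⟩
  by_cases ht : (if l = k then i else k) = m
  · refine ⟨1, CoprodI.of y⁻¹, 1, len_of_le _, retr_of_mem hl _, .one, fun x => ?_⟩
    rw [triTwist_of, ht]
    simp
  · refine ⟨CoprodI.of y, CoprodI.of y, partialConj l y⁻¹, len_of_le _, retr_of_mem hl _,
      .partialConj_self _, fun x => ?_⟩
    rw [triTwist_of]
    refine partialConj_retr_eq hlm (ite_ne_self hik l) (Ne.symm ht) (fun n hn => ?_) y x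
    simp only [Finset.mem_insert, Finset.mem_singleton] at hm hl hn
    grind

/-- Modulo the remaining factors, conjugations and automorphisms of the factors, a product of `m`
partial conjugations acts on three factors as a product of at most `m` twists. -/
theorem exists_retr_prod_eq (hik : i ≠ k) (L : List (MulAut (CoprodI A)))
    (hL : ∀ σ ∈ L, σ ∈ partialConjSet A) :
    ∃ (c u : CoprodI A) (e : MulAut (CoprodI A)), len u ≤ L.length ∧ retr {i, j, k} u = u ∧
      IsFactorwise e ∧ ∀ x, retr {i, j, k} (L.prod x) =
        c * triTwist hik u (e (retr {i, j, k} x)) * c⁻¹ := by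
  induction L using List.reverseRecOn with
  | nil => exact ⟨1, 1, 1, by simp, by simp, .one, fun x => by simp⟩
  | append_singleton L σ ih =>
    obtain ⟨c, u, e, hu, hu', he, h⟩ := ih fun τ hτ => hL τ (List.mem_append_left _ hτ)
    obtain ⟨⟨m, l, y⟩, rfl⟩ := hL σ (by simp)
    simp only [List.prod_append, List.prod_singleton, MulAut.mul_apply, h, List.length_append,
      List.length_singleton]
    by_cases hml : m ∈ ({i, j, k} : Finset ι) ∧ l ∈ ({i, j, k} : Finset ι)
    -- Moving the new partial conjugation left past e only replaces y by y'; its conjugator is then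
    -- absorbed into c and its letter appended to u.
    · obtain ⟨y', hy'⟩ := he.exists_apply_partialConj (m := m) y
      obtain ⟨c₁, u₁, e₁, h1, h1', he₁, H⟩ := exists_partialConj_retr_eq hik hml.1 hml.2 y'
      refine ⟨c * triTwist hik u c₁, u * u₁, e₁ * e, (len_mul_le _ _).trans (by omega),
        by rw [map_mul, hu', h1'], he₁.mul he, fun x => ?_⟩
      rw [retr_partialConj hml.1 hml.2, hy', ← he.retr_apply, H, he.retr_apply]
      simp [mul_assoc]
    · refine ⟨c, u, e, by omega, hu', he, fun x => ?_⟩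
      rw [retr_partialConj_of_not hml]

/-- Letters of A i and A j twist only A k, so on words in them the twist is the k-component of a
multiple partial conjugation. -/
theorem triTwist_retr_of (hik : i ≠ k) (hjk : j ≠ k) (W : CoprodI A) :
    (∀ m ∈ ({i, j} : Finset ι), ∀ a : A m,
      triTwist hik (retr {i, j} W) (CoprodI.of a) = CoprodI.of a) ∧
    ∀ a : A k, triTwist hik (retr {i, j} W) (CoprodI.of a) =
      (retr {i, j} W)⁻¹ * CoprodI.of a * retr {i, j} W := by
  induction W using CoprodI.induction_left with
  | one => simp
  | mul x W ih =>
    rename_i n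
    by_cases hn : n ∈ ({i, j} : Finset ι)
    · have hne : ∀ m ∈ ({i, j} : Finset ι), m ≠ k := by
        intro m hm
        simp only [Finset.mem_insert, Finset.mem_singleton] at hm
        rcases hm with rfl | rfl <;> assumption
      have fix : ∀ w, partialConj k x⁻¹ (retr {i, j} w) = retr {i, j} w :=
        apply_retr (f := (partialConj k x⁻¹).toMonoidHom)
          fun m hm a => partialConj_of_ne (hne m hm) _ a
      rw [map_mul, retr_of_mem hn, map_mul, triTwist_of, if_neg (hne n hn)]
      constructor
      · intro m hm a
        rw [MulAut.mul_apply, ih.1 m hm, partialConj_of_ne (hne m hm)]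
      · intro a
        rw [MulAut.mul_apply, ih.2, map_mul, map_mul, map_inv, fix, partialConj_of_self]
        simp [mul_assoc]
    · rwa [map_mul, retr_of_notMem hn, one_mul]

theorem retr_multiConj (hik : i ≠ k) (hjk : j ≠ k) (V : {k : ι // k ≠ i ∧ k ≠ j} → CoprodI A)
    (x : CoprodI A) : retr {i, j, k} (multiConj A i j V x) =
      triTwist hik (retr {i, j} (V ⟨k, hik.symm, hjk.symm⟩)) (retr {i, j, k} x) := by
  have hsub : ({i, j} : Finset ι) ⊆ {i, j, k} := by
    intro m
    simp only [Finset.mem_insert, Finset.mem_singleton]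
    tauto
  obtain ⟨h1, h2⟩ := triTwist_retr_of hik hjk (V ⟨k, hik.symm, hjk.symm⟩)
  have : (retr {i, j, k}).comp (multiHom i j V) =
      (triTwist hik (retr {i, j} (V ⟨k, hik.symm, hjk.symm⟩))).toMonoidHom.comp
        (retr {i, j, k}) := by
    refine CoprodI.ext_hom _ _ fun m => MonoidHom.ext fun a => ?_
    by_cases hm : m ∈ ({i, j} : Finset ι)
    · simp [multiHom_of_mem hm, retr_of_mem (hsub hm), h1 m hm]
    by_cases hmk : m = k
    · subst hmk
      have hs : m ∈ ({i, j, m} : Finset ι) := by simp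
      have := multiHom_of ⟨m, hik.symm, hjk.symm⟩ V a
      simp only [MonoidHom.comp_apply, MulEquiv.toMonoidHom_eq_coe, MonoidHom.coe_coe]
      rw [this, retr_of_mem hs, h2, map_mul, map_mul, map_inv, retr_of_mem hs,
        retr_retr_of_subset hsub]
    · have hms : m ∉ ({i, j, k} : Finset ι) := by
        simp only [Finset.mem_insert, Finset.mem_singleton] at hm ⊢
        tauto
      have := multiHom_of ⟨m, by simpa using hm⟩ V a
      simp only [MonoidHom.comp_apply, MulEquiv.toMonoidHom_eq_coe, MonoidHom.coe_coe]
      rw [this, retr_of_notMem hms, map_mul, map_mul, map_inv, retr_of_notMem hms]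
      simp
  exact DFunLike.congr_fun this x

/-- The length of each component of a multiple partial conjugation is at most the number of
partial conjugations needed to express it. -/
theorem len_retr_le [∀ i, Nontrivial (A i)] (hij : i ≠ j) (hik : i ≠ k) (hjk : j ≠ k)
    {V : {k : ι // k ≠ i ∧ k ≠ j} → CoprodI A} {g : CoprodI A} {L : List (MulAut (CoprodI A))}
    (hL : ∀ σ ∈ L, σ ∈ partialConjSet A) {e : MulAut (CoprodI A)} (he : IsFactorwise e)
    (h : multiConj A i j V = MulAut.conj g * L.prod * e) :
    len (retr {i, j} (V ⟨k, hik.symm, hjk.symm⟩)) ≤ L.length := by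
  have hsub : ({i, j} : Finset ι) ⊆ {i, j, k} := by
    intro m
    simp only [Finset.mem_insert, Finset.mem_singleton]
    tauto
  obtain ⟨c, u, e', hu, hu', he', H⟩ := exists_retr_prod_eq (j := j) hik L hL
  set w := retr {i, j} (V ⟨k, hik.symm, hjk.symm⟩) with hw
  -- The twists by u and w agree on the three factors up to a conjugation and a factorwise
  -- automorphism, so ping-pong applies to u⁻¹w.
  have key : u⁻¹ * w = 1 := by
    refine eq_one_of_triTwist hij hik hjk ?_
      (c := triTwist hik u⁻¹ (retr {i, j, k} g * c)) fun m hm a => ?_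
    · rw [map_mul, map_inv, hu', hw, retr_retr_of_subset hsub]
    · obtain ⟨b, hb⟩ := (he'.mul he) m a
      refine ⟨b, ?_⟩
      rw [MulAut.mul_apply] at hb
      have h1 := retr_multiConj hik hjk V (CoprodI.of a)
      rw [← hw, h, MulAut.mul_apply, MulAut.mul_apply, MulAut.conj_apply, map_mul, map_mul, H,
        he.retr_apply, retr_of_mem hm, hb] at h1
      rw [map_mul, MulAut.mul_apply, ← h1]
      simp [mul_assoc]
  rwa [← inv_mul_eq_one.1 key]

end ThreeFactors

/-! ### Word metrics -/

section WordMetric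

open SimpleGraph
open scoped Pointwise

variable {G : Type*} [Group G] {S : Set G}

theorem exists_list_of_closure_eq_top (hS : Subgroup.closure S = ⊤) (x : G) :
    ∃ L : List G, (∀ s ∈ L, s ∈ S ∪ S⁻¹) ∧ L.prod = x := by
  refine Submonoid.exists_list_of_mem_closure ?_
  rw [← Subgroup.closure_toSubmonoid, hS]
  trivial

theorem exists_walk_of_list (L : List G) (hL : ∀ s ∈ L, s ∈ S ∪ S⁻¹) (x : G) :
    ∃ p : (mulCayley S).Walk x (x * L.prod), p.length ≤ L.length := by
  induction L generalizing x with
  | nil => exact ⟨(Walk.nil : (mulCayley S).Walk x x).copy rfl (by simp),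
      (Walk.length_copy _ _ _).le⟩
  | cons s L ih =>
    obtain ⟨p, hp⟩ := ih (fun t ht => hL t (List.mem_cons_of_mem _ ht)) (x * s)
    -- The graph has no loops, so trivial letters give no edge; hence only an inequality of lengths.
    by_cases hs : s = 1
    · exact ⟨p.copy (by simp [hs]) (by simp [hs]),
        (Walk.length_copy _ _ _).le.trans (hp.trans (Nat.le_succ _))⟩
    · have hadj : (mulCayley S).Adj x (x * s) := by
        rw [mulCayley_adj]
        refine ⟨by simpa using hs, ?_⟩
        have := hL s (by simp)
        simpa using this
      exact ⟨(Walk.cons hadj p).copy rfl (by simp [mul_assoc]), by simpa using hp⟩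

theorem dist_mul_list_le (L : List G) (hL : ∀ s ∈ L, s ∈ S ∪ S⁻¹) (x : G) :
    (mulCayley S).dist x (x * L.prod) ≤ L.length := by
  obtain ⟨p, hp⟩ := exists_walk_of_list L hL x
  exact (dist_le p).trans hp

theorem exists_list_of_walk {x y : G} (p : (mulCayley S).Walk x y) :
    ∃ L : List G, (∀ s ∈ L, s ∈ S ∪ S⁻¹) ∧ L.length = p.length ∧ x * L.prod = y := by
  induction p with
  | nil => exact ⟨[], by simp⟩
  | @cons u v w h p ih =>
    obtain ⟨L, hL, hlen, hprod⟩ := ih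
    refine ⟨(u⁻¹ * v) :: L, ?_, by simp [hlen], by simp [← hprod, mul_assoc]⟩
    rw [mulCayley_adj] at h
    simp only [List.mem_cons, forall_eq_or_imp]
    exact ⟨by simpa using h.2, hL⟩

/-- Reachability has to come first, since `dist` takes the value 0 between unreachable vertices. -/
theorem exists_list_length_eq_dist (hS : Subgroup.closure S = ⊤) (x y : G) :
    ∃ L : List G, (∀ s ∈ L, s ∈ S ∪ S⁻¹) ∧ L.length = (mulCayley S).dist x y ∧
      x * L.prod = y := by
  obtain ⟨L, hL, hprod⟩ := exists_list_of_closure_eq_top hS (x⁻¹ * y)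
  obtain ⟨p, -⟩ := exists_walk_of_list L hL x
  have hr : (mulCayley S).Reachable x y := by
    rw [hprod, mul_inv_cancel_left] at p
    exact ⟨p⟩
  obtain ⟨q, hq⟩ := hr.exists_walk_length_eq_dist
  rw [← hq]
  exact exists_list_of_walk q

theorem dist_mul_mul_le (hS : Subgroup.closure S = ⊤) (x y z : G) :
    (mulCayley S).dist (x * y) (x * z) ≤ (mulCayley S).dist y z := by
  obtain ⟨L, hL, hlen, rfl⟩ := exists_list_length_eq_dist hS y z
  rw [← hlen, ← mul_assoc]
  exact dist_mul_list_le L hL (x * y)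

theorem dist_mul_left_le (hS : Subgroup.closure S = ⊤) (x z : G) :
    (mulCayley S).dist x (x * z) ≤ (mulCayley S).dist 1 z := by
  simpa using dist_mul_mul_le hS x 1 z

theorem dist_one_mul_le (hS : Subgroup.closure S = ⊤) (y z : G) :
    (mulCayley S).dist 1 (y * z) ≤ (mulCayley S).dist 1 y + (mulCayley S).dist 1 z := by
  obtain ⟨L, hL, hlen, hprod⟩ := exists_list_length_eq_dist hS 1 y
  obtain ⟨M, hM, hlen', hprod'⟩ := exists_list_length_eq_dist hS 1 z
  have := dist_mul_list_le (L ++ M) (fun s hs => (List.mem_append.1 hs).elim (hL s) (hM s)) 1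
  rw [one_mul] at hprod hprod' this
  rwa [List.prod_append, hprod, hprod', List.length_append, hlen, hlen'] at this

/-- A homomorphism does not increase distances by more than a constant factor. -/
theorem exists_dist_map_le {G' : Type*} [Group G'] {T : Set G'} (hTf : T.Finite)
    (hS : Subgroup.closure S = ⊤) (hT : Subgroup.closure T = ⊤) (f : G' →* G) :
    ∃ C : ℕ, ∀ x y, (mulCayley S).dist (f x) (f y) ≤ C * (mulCayley T).dist x y := by
  obtain ⟨C, hC⟩ := ((hTf.union hTf.inv).image fun t => (mulCayley S).dist 1 (f t)).bddAbove
  refine ⟨C, fun x y => ?_⟩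
  obtain ⟨L, hL, hlen, rfl⟩ := exists_list_length_eq_dist hT x y
  rw [← hlen, map_mul]
  refine (dist_mul_left_le hS _ _).trans ?_
  clear hlen
  induction L with
  | nil => simp
  | cons s L ih =>
    rw [List.prod_cons, map_mul, List.length_cons, mul_add_one, add_comm]
    exact (dist_one_mul_le hS _ _).trans (add_le_add (hC ⟨s, hL s (by simp), rfl⟩)
      (ih fun t ht => hL t (List.mem_cons_of_mem _ ht)))

end WordMetric

/-! ### The subgroup is undistorted -/

section Undistorted

open SimpleGraph
open scoped Pointwise

variable {ι : Type*} [DecidableEq ι] {A : ι → Type*} [∀ i, Group (A i)]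

theorem partialConj_inv (i : ι) {j : ι} (x : A j) : (partialConj i x)⁻¹ = partialConj i x⁻¹ :=
  inv_eq_of_mul_eq_one_right <| MulEquiv.ext fun g =>
    DFunLike.congr_fun (partialConjHom_comp_inv i x) g

theorem partialConjSet_inv : (partialConjSet A)⁻¹ = partialConjSet A := by
  have : ∀ σ ∈ partialConjSet A, σ⁻¹ ∈ partialConjSet A := by
    rintro _ ⟨⟨i, j, x⟩, rfl⟩
    rw [partialConj_inv]
    exact partialConj_mem i x⁻¹
  ext σ
  exact ⟨fun h => inv_inv σ ▸ this _ h, fun h => this σ h⟩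

theorem exists_list_partialConj {φ : MulAut (CoprodI A)}
    (h : φ ∈ Subgroup.closure (partialConjSet A)) :
    ∃ P : List (MulAut (CoprodI A)), (∀ σ ∈ P, σ ∈ partialConjSet A) ∧ P.prod = φ := by
  refine Submonoid.exists_list_of_mem_closure ?_
  rw [← Subgroup.mem_toSubmonoid, Subgroup.closure_toSubmonoid, partialConjSet_inv,
    Set.union_self] at h
  exact h

/-- Factor permutations normalize the set of partial conjugations, so they can be collected on the
right at no cost in length. -/
theorem IsFactorAut.mul_list {e : MulAut (CoprodI A)} (he : IsFactorAut e)
    (P : List (MulAut (CoprodI A))) (hP : ∀ σ ∈ P, σ ∈ partialConjSet A) :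
    ∃ Q : List (MulAut (CoprodI A)), (∀ σ ∈ Q, σ ∈ partialConjSet A) ∧ Q.length = P.length ∧
      e * P.prod = Q.prod * e := by
  induction P with
  | nil => exact ⟨[], by simp⟩
  | cons σ P ih =>
    obtain ⟨Q, hQ, hlen, hprod⟩ := ih fun τ hτ => hP τ (List.mem_cons_of_mem _ hτ)
    obtain ⟨⟨i, j, x⟩, rfl⟩ := hP σ (by simp)
    obtain ⟨k, l, y, hy⟩ := he.mul_partialConj i x
    refine ⟨partialConj k y :: Q, ?_, by simp [hlen], ?_⟩
    · simp only [List.mem_cons, forall_eq_or_imp]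
      exact ⟨partialConj_mem k y, hQ⟩
    · simp only [List.prod_cons]
      rw [← mul_assoc, hy, mul_assoc, hprod, mul_assoc]

theorem exists_list_factorAut [Finite ι] [∀ i, Finite (A i)] [∀ i, Nontrivial (A i)]
    (γ : Out (CoprodI A)) : ∃ (P : List (MulAut (CoprodI A))) (e : MulAut (CoprodI A)),
      (∀ σ ∈ P, σ ∈ partialConjSet A) ∧ IsFactorAut e ∧ γ = QuotientGroup.mk (P.prod * e) := by
  obtain ⟨φ, rfl⟩ := QuotientGroup.mk_surjective γ
  obtain ⟨s, hs, e, he, rfl⟩ := exists_eq_mul_factorAut φ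
  obtain ⟨P, hP, rfl⟩ := exists_list_partialConj hs
  exact ⟨P, e, hP, he, rfl⟩

/-- The number of partial conjugations needed to express an outer automorphism, up to a permutation
of the factors, grows at most linearly with the word length. -/
theorem exists_list_factorAut_le [Finite ι] [∀ i, Finite (A i)] [∀ i, Nontrivial (A i)]
    {S : Set (Out (CoprodI A))} (hS : S.Finite) :
    ∃ C : ℕ, ∀ L : List (Out (CoprodI A)), (∀ s ∈ L, s ∈ S ∪ S⁻¹) →
      ∃ (P : List (MulAut (CoprodI A))) (e : MulAut (CoprodI A)),
        (∀ σ ∈ P, σ ∈ partialConjSet A) ∧ IsFactorAut e ∧ P.length ≤ C * L.length ∧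
          L.prod = QuotientGroup.mk (P.prod * e) := by
  choose P e hP he hPe using exists_list_factorAut (A := A)
  obtain ⟨C, hC⟩ := ((hS.union hS.inv).image fun s => (P s).length).bddAbove
  refine ⟨C, fun L hL => ?_⟩
  induction L with
  | nil => exact ⟨[], 1, by simp, .one, by simp, by simp⟩
  | cons s L ih =>
    obtain ⟨Q, f, hQ, hf, hlen, hprod⟩ := ih fun t ht => hL t (List.mem_cons_of_mem _ ht)
    obtain ⟨R, hR, hRlen, hRprod⟩ := (he s).mul_list Q hQ
    refine ⟨P s ++ R, e s * f, ?_, (he s).mul hf, ?_, ?_⟩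
    · intro σ hσ
      exact (List.mem_append.1 hσ).elim (hP s σ) (hR σ)
    · rw [List.length_append, List.length_cons, hRlen, mul_add_one, add_comm]
      exact add_le_add hlen (hC ⟨s, hL s (by simp), rfl⟩)
    · rw [List.prod_cons, hprod]
      conv_lhs => rw [hPe s]
      rw [← QuotientGroup.mk_mul, List.prod_append]
      congr 1
      rw [mul_assoc, ← mul_assoc (e s), hRprod]
      simp only [mul_assoc]

theorem exists_isConjBy_list (P : List (MulAut (CoprodI A)))
    (hP : ∀ σ ∈ P, σ ∈ partialConjSet A) : ∃ g, IsConjBy P.prod g := by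
  induction P using List.reverseRecOn with
  | nil => exact ⟨1, fun k a => by simp⟩
  | append_singleton P σ ih =>
    obtain ⟨g, hg⟩ := ih fun τ hτ => hP τ (List.mem_append_left _ hτ)
    obtain ⟨⟨i, j, x⟩, rfl⟩ := hP σ (by simp)
    rw [List.prod_append, List.prod_singleton]
    exact ⟨_, hg.mul_partialConj x i⟩

/-- If φ and φ e both conjugate every factor, then e sends A k into A (σ k) and into a conjugate of
A k, so σ is trivial by malnormality. -/
theorem IsFactorAut.isFactorwise [∀ i, Nontrivial (A i)] {e : MulAut (CoprodI A)}
    (he : IsFactorAut e) {φ : MulAut (CoprodI A)} {g : ι → CoprodI A} (hφ : IsConjBy φ g)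
    {f : ι → CoprodI A} (h : IsConjBy (φ * e) f) : IsFactorwise e := by
  obtain ⟨σ, α, hα⟩ := he
  have hσ : ∀ k, σ k = k := by
    intro k
    obtain ⟨a, ha⟩ := exists_ne (1 : A k)
    refine (malnormal (g := (g (σ k))⁻¹ * f k) (b := α k a) ha ?_).1.symm
    have h1 := h k a
    rw [MulAut.mul_apply, hα, hφ] at h1
    have : (g (σ k))⁻¹ * f k * CoprodI.of a * ((g (σ k))⁻¹ * f k)⁻¹ =
      (g (σ k))⁻¹ * (f k * CoprodI.of a * (f k)⁻¹) * g (σ k) := by group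
    rw [this, ← h1]
    group
  have cast : ∀ (k l : ι) (b : A l), l = k →
      ∃ c : A k, (CoprodI.of b : CoprodI A) = CoprodI.of c := by
    rintro k _ b rfl
    exact ⟨b, rfl⟩
  intro k a
  rw [hα]
  exact cast _ _ _ (hσ k)

variable {i j : ι}

theorem exists_isConjBy_multiConj (V : {k : ι // k ≠ i ∧ k ≠ j} → CoprodI A) :
    ∃ f, IsConjBy (multiConj A i j V) f := by
  have : ∀ m, ∃ f : CoprodI A, ∀ a : A m,
      multiConj A i j V (CoprodI.of a) = f * CoprodI.of a * f⁻¹ := by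
    intro m
    by_cases hm : m ∈ ({i, j} : Finset ι)
    · exact ⟨1, fun a => by rw [multiConj_apply, multiHom_of_mem hm]; simp⟩
    · refine ⟨(retr {i, j} (V ⟨m, by simpa using hm⟩))⁻¹, fun a => ?_⟩
      rw [inv_inv]
      exact multiHom_of ⟨m, by simpa using hm⟩ V a
  choose f hf using this
  exact ⟨f, hf⟩

/-- The length of each component of an element of `HH A i j` is at most a multiple of its distance
from the identity in the outer automorphism group. -/
theorem exists_len_retr_le [Finite ι] [∀ i, Finite (A i)] [∀ i, Nontrivial (A i)] (hij : i ≠ j)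
    {S : Set (Out (CoprodI A))} (hSf : S.Finite) (hS : Subgroup.closure S = ⊤) :
    ∃ C : ℕ, ∀ (V : {k : ι // k ≠ i ∧ k ≠ j} → CoprodI A) (k : {k : ι // k ≠ i ∧ k ≠ j}),
      len (retr {i, j} (V k)) ≤ C * (mulCayley S).dist 1 (outerMulti A i j V) := by
  obtain ⟨C, hC⟩ := exists_list_factorAut_le hSf
  refine ⟨C, fun V k => ?_⟩
  obtain ⟨L, hL, hlen, hprod⟩ := exists_list_length_eq_dist hS 1 (outerMulti A i j V)
  obtain ⟨P, e, hP, he, hPlen, hPprod⟩ := hC L hL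
  rw [one_mul, hPprod] at hprod
  obtain ⟨g, hg⟩ := QuotientGroup.eq.1 hprod
  obtain ⟨f, hf⟩ := exists_isConjBy_multiConj V
  obtain ⟨p, hp⟩ := exists_isConjBy_list P hP
  have e1 : multiConj A i j V = MulAut.conj ((P.prod * e) g) * P.prod * e := by
    rw [← mul_inv_cancel_left (P.prod * e) (multiConj A i j V), ← hg]
    ext x
    simp
  have he' : IsFactorwise e := by
    refine he.isFactorwise (g := fun m => (P.prod * e) g * p m) (fun m a => ?_) (e1 ▸ hf)
    rw [MulAut.mul_apply, hp, MulAut.conj_apply]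
    simp [mul_assoc]
  rw [← hlen]
  exact (len_retr_le hij k.2.1.symm k.2.2.symm hP he' e1).trans hPlen

/-- A subadditive function on a product of free products of finite groups grows at most linearly
with the total length. -/
theorem exists_le_sum_len {κ : Type*} [Fintype κ] [DecidableEq κ] [Finite ι]
    [∀ i, Finite (A i)] (ℓ : (κ → CoprodI A) → ℕ) (h1 : ℓ 1 = 0)
    (hmul : ∀ V W, ℓ (V * W) ≤ ℓ V + ℓ W) :
    ∃ C : ℕ, ∀ V, ℓ V ≤ C * ∑ k, len (V k) := by
  obtain ⟨C, hC⟩ := (Set.finite_range fun p : κ × (Σ m, A m) =>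
    ℓ (Pi.mulSingle p.1 (CoprodI.of p.2.2))).bddAbove
  refine ⟨C, fun V => ?_⟩
  induction hN : ∑ k, len (V k) using Nat.strong_induction_on generalizing V with
  | _ N ih =>
  by_cases hV : V = 1
  · rw [hV, h1]
    exact Nat.zero_le _
  obtain ⟨k, hk⟩ := Function.ne_iff.1 hV
  obtain ⟨⟨m, x⟩, t, e⟩ := List.exists_cons_of_ne_nil (fun e => hk (nf_eq_nil.1 e))
  -- Split the first letter off one nontrivial component; it costs at most C and lowers the total
  -- length.
  have hdec : V = Pi.mulSingle k (CoprodI.of x) * Function.update V k (lprod t) := by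
    funext l
    by_cases hl : l = k
    · subst hl
      rw [Pi.mul_apply, Pi.mulSingle_eq_same, Function.update_self]
      conv_lhs => rw [← lprod_nf (V l), e, lprod_cons]
    · simp [hl]
  have hlt : ∑ l, len (Function.update V k (lprod t) l) < N := by
    rw [← hN]
    refine Finset.sum_lt_sum (fun l _ => ?_) ⟨k, Finset.mem_univ _, ?_⟩
    · by_cases hl : l = k
      · subst hl
        simpa [len, e] using (len_lprod_le t).trans (Nat.le_succ _)
      · simp [hl]
    · simpa [len, e] using Nat.lt_succ_of_le (len_lprod_le t)
  have h2 := ih _ hlt _ rfl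
  have h3 : ℓ (Pi.mulSingle k (CoprodI.of x)) ≤ C := hC ⟨(k, ⟨m, x⟩), rfl⟩
  have h4 := hmul (Pi.mulSingle k (CoprodI.of x)) (Function.update V k (lprod t))
  rw [← hdec] at h4
  calc ℓ V ≤ C + C * ∑ l, len (Function.update V k (lprod t) l) := h4.trans (add_le_add h3 h2)
    _ = C * (∑ l, len (Function.update V k (lprod t) l) + 1) := by ring
    _ ≤ C * N := Nat.mul_le_mul_left C hlt

theorem fg_HH [Finite ι] [∀ i, Finite (A i)] : Group.FG (HH A i j) := by
  have hfin : ∀ k l, (H A k l).FG := by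
    intro k l
    have : Finite (H A k l) := Set.finite_range fun x : A l => outerPartialConj k x
    exact (Group.fg_iff_subgroup_fg _).1 inferInstance
  exact (Group.fg_iff_subgroup_fg _).2 (Subgroup.FG.iSup _ fun k => (hfin k i).sup (hfin k j))

theorem outerMulti_retr (V : {k : ι // k ≠ i ∧ k ≠ j} → CoprodI A) :
    outerMulti A i j (fun k => retr {i, j} (V k)) = outerMulti A i j V := by
  have : multiHom i j (fun k => retr {i, j} (V k)) = multiHom i j V :=
    eq_multiHom (fun m hm a => multiHom_of_mem hm _ a) fun k a => by
      rw [multiHom_of, retr_retr_of_subset subset_rfl]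
  exact congrArg QuotientGroup.mk (MulEquiv.ext fun x => DFunLike.congr_fun this x)

-- The upper bound holds for any homomorphism. For the other, word length in `HH A i j` is bounded
-- linearly by the total length of the retracted components, each of which is bounded by
-- `exists_len_retr_le`.
variable (A) in
theorem isUndistorted_HH [Finite ι] [∀ i, Finite (A i)] [∀ i, Nontrivial (A i)] (hij : i ≠ j) :
    IsUndistorted (HH A i j) := by
  refine ⟨fg_out A, fg_HH, fun S T hSf hTf hS hT => ?_⟩
  have := Fintype.ofFinite ι
  obtain ⟨C₁, hC₁⟩ := exists_dist_map_le hTf hS hT (HH A i j).subtype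
  let F : ({k : ι // k ≠ i ∧ k ≠ j} → CoprodI A) →* HH A i j :=
    (outerMulti A i j).codRestrict (HH A i j) fun V => by
      rw [← range_outerMulti A hij]
      exact ⟨V, rfl⟩
  obtain ⟨C₂, hC₂⟩ := exists_le_sum_len (fun V => (mulCayley T).dist 1 (F V)) (by simp)
    fun V W => by
      rw [map_mul]
      exact dist_one_mul_le hT _ _
  obtain ⟨C₃, hC₃⟩ := exists_len_retr_le hij hSf hS
  have key : ∀ x y : HH A i j, (mulCayley T).dist x y ≤
      C₂ * (Fintype.card {k : ι // k ≠ i ∧ k ≠ j} * C₃) * (mulCayley S).dist (x : Out _) y := by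
    intro x y
    obtain ⟨V, hV⟩ : ∃ V, outerMulti A i j V = (x⁻¹ * y : HH A i j) :=
      (range_outerMulti A hij).ge (x⁻¹ * y).2
    have hF : F (fun k => retr {i, j} (V k)) = x⁻¹ * y :=
      Subtype.ext ((outerMulti_retr V).trans hV)
    have d1 : (mulCayley T).dist x y ≤ (mulCayley T).dist 1 (x⁻¹ * y) := by
      simpa using dist_mul_left_le hT x (x⁻¹ * y)
    have d2 : (mulCayley S).dist (1 : Out (CoprodI A)) (x⁻¹ * y : HH A i j) ≤
        (mulCayley S).dist (x : Out (CoprodI A)) y := by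
      simpa using dist_mul_mul_le hS (x : Out (CoprodI A))⁻¹ x y
    have d3 := hC₂ fun k => retr {i, j} (V k)
    simp only [hF] at d3
    have d4 : ∑ k, len (retr {i, j} (V k)) ≤ Fintype.card {k : ι // k ≠ i ∧ k ≠ j} *
        (C₃ * (mulCayley S).dist (1 : Out (CoprodI A)) (x⁻¹ * y : HH A i j)) := by
      rw [← hV]
      exact (Finset.sum_le_card_nsmul _ _ _ fun k _ => hC₃ V k).trans_eq (by simp)
    calc (mulCayley T).dist x y ≤ C₂ * ∑ k, len (retr {i, j} (V k)) := d1.trans d3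
      _ ≤ C₂ * (Fintype.card {k : ι // k ≠ i ∧ k ≠ j} *
          (C₃ * (mulCayley S).dist (x : Out (CoprodI A)) y)) := by
        gcongr
        exact d4.trans (by gcongr)
      _ = _ := by ring
  set C₄ := C₂ * (Fintype.card {k : ι // k ≠ i ∧ k ≠ j} * C₃)
  -- One multiplicative constant dominates both bounds; the summand 1 makes it at least 1, and no
  -- additive constant is needed.
  refine ⟨C₁ + C₄ + 1, 0, by linarith [C₁.cast_nonneg (α := ℝ), C₄.cast_nonneg (α := ℝ)], le_rfl,
    fun x y => ⟨?_, ?_⟩⟩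
  · have h : ((mulCayley T).dist x y : ℝ) ≤ C₄ * (mulCayley S).dist (x : Out (CoprodI A)) y := by
      exact_mod_cast key x y
    rw [sub_zero, div_le_iff₀ (by positivity), mul_comm]
    refine h.trans ?_
    gcongr
    linarith [C₁.cast_nonneg (α := ℝ)]
  · have h : ((mulCayley S).dist (x : Out (CoprodI A)) y : ℝ) ≤ C₁ * (mulCayley T).dist x y := by
      exact_mod_cast hC₁ x y
    rw [add_zero]
    refine h.trans ?_
    gcongr
    linarith [C₄.cast_nonneg (α := ℝ)]

end Undistorted

end FreeProductOut

theorem mainTheorem3 {n : ℕ} (A : Fin n → Type*) [∀ k, Group (A k)] [∀ k, Finite (A k)]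
    [∀ k, Nontrivial (A k)] (i j : Fin n) (hij : i ≠ j) :
    FreeProductOut.HHIsDirectSum A i j ∧
      FreeProductOut.IsUndistorted (FreeProductOut.HH A i j) :=
  ⟨FreeProductOut.hhIsDirectSum A hij, FreeProductOut.isUndistorted_HH A hij⟩
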